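/- All systems are finite-dimensional. For a matrix $M$ let $\|M\|_1=\mathrm{Tr}\sqrt{M^\dagger M}$. For sub-normalized states ($\rho\ge 0$, $\mathrm{Tr}\,\rho\le 1$) let $F(\rho,\tau)=\|\sqrt\rho\sqrt\tau\|_1+\sqrt{(1-\mathrm{Tr}\rho)(1-\mathrm{Tr}\tau)}$ and $P(\rho,\tau)=\sqrt{1-F(\rho,\tau)^2}$. $H_{\min}(\rho_{AE}|E)$ is the largest $\lambda$ with $\rho_{AE}\le 2^{-\lambda}\,\mathbb 1_A\otimes\sigma_E$ for some normalized state $\sigma_E$, and $H_{\min}^{\varepsilon}(\rho_{AE}|E)$ is the maximum of $H_{\min}(\bar\rho_{AE}|E)$ over sub-normalized $\bar\rho_{AE}$ with $P(\bar\rho_{AE},\rho_{AE})\le\varepsilon$. A random function $f$ into $\{0,1\}^k$ is universal$_2$ if $\Pr(f(x)=f(y))\le 2^{-k}$ for all $x\ne y$. Consider a QKD scheme of the following form. (0) The initial (sub-normalized) state is on $A'B'E$, where $E$ is Eve's. (1) Sample measurement: Alice and Bob measure $A'B'$, announce a message (stored in Eve's system), and continue only on certain outcomes. (2) Sifted key measurement: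 Alice measures $A'$ and Bob measures $B'$, obtaining $a,b\in\{0,1\}^n$; $\rho^{\rm sif}_{AE}$ is the resulting sub-normalized state of $a$ and Eve. (3) Information reconciliation: exchanging one-time-pad encrypted messages, Bob produces $b^{\rm cor}$ from $b$; Alice announces a universal$_2$ function $u:\{0,1\}^n\to\{0,1\}^l$ and sends $u(a)$ one-time-pad encrypted, and a key is output only if $u(a)=u(b^{\rm cor})$. (4) Privacy amplification: Alice announces, in a register $G$, a universal$_2$ hash function $g:\{0,1\}^n\to\{0,1\}^m$, each $g$ being linear and surjective; the keys are $k=g(a)$, $k'=g(b^{\rm cor})$. Let $\rho^{\rm fin}_{KK'EG}$ be the final sub-normalized state ($E$ comprises all that Eve holds, the cipher texts and $u$ included), and $$D_1(\rho^{\rm fin}_{KK'EG})=\Big\|\rho^{\rm fin}_{KK'EG}-2^{-m}\sum_k|k\rangle\langle k|_K\otimes|k\rangle\langle k|_{K'}\otimes\rho^{\rm fin}_E\otimes\sum_g\Pr(G=g)|g\rangle\langle g|_G\Big\|_1 .$$ For a state $\rho_{KEG}$ let $d_1(\rho_{KEG})=\|\rho_{KEG}-2^{-m}\,\mathbb 1_K\otimes\rho_E\otimes\sum_g\Pr(G=g)|g\rangle\langle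 g|_G\|_1$. Assume $H_{\min}^{\varepsilon'''}(\rho^{\rm sif}_{AE}|E)\ge H^{\rm th}_{\min}$ for a real number $H^{\rm th}_{\min}$. Then $$D_1(\rho^{\rm fin}_{KK'EG})\le 2^{-l+1}+2\varepsilon'''+2^{\frac12[m-H_{\min}^{\rm th}+3]} .$$ Moreover, the following virtual scheme exists. The initial state has a purification. From any purification, carrying out the sample measurement and Alice's sifted key measurement coherently (isometries recording the outcomes in ancillas, then projection onto the accepted outcomes) gives a vector that is a semi-purification of $\rho^{\rm sif}_{AE}$: measuring $A$ of its reduced state on $AE$ in the $Z$ basis gives $\rho^{\rm sif}_{AE}$. Let $|\Phi\rangle_{AEC}$ be any semi-purification of $\rho^{\rm sif}_{AE}$. For each $g$ let $h$ be a full-rank $(n-m)\times n$ matrix with $hg^T=0$, and for each $g$ and $s\in\{0,1\}^{n-m}$ let $\{E^{g,s,e}\}_{e\in\{0,1\}^n}$ be any measurement ($\sum_e E^{g,s,e\dagger}E^{g,s,e}=\mathbb 1$) of the ancilla introduced below. Twirl, i.e. add an $n$-qubit register $T$ in $|0\rangle$ and apply $\sum_z|z\rangle\langle z|_A\otimes X^z_T$;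 choose $g$ with probability $\Pr(G=g)$; perform phase error correction: measure the syndrome $s$ of the operators $X^{h_j}$ on $A$, measure the ancilla $CT$ with $\{E^{g,s,e}\}_e$, apply $Z^e$ to $A$; finally measure $Z^{g_1},\dots,Z^{g_m}$ on $A$ and store the outcome $k$ in $K$. Then: the twirled vector is a purification of $\rho^{\rm sif}_{AE}$; the final state $\rho^{\rm vir}_{KEG}$ equals the reduced state of the actual scheme on Alice's key, Eve's system before step (3), and $G$, when the outcome of the verification is disregarded; with $P^{\rm ph}_g=1-\langle\tilde 0|\rho_A|\tilde 0\rangle$ the phase error probability after the error correction for $g$, where $|\tilde 0\rangle=2^{-n/2}\sum_z|z\rangle$, one has $d_1(\rho^{\rm vir}_{KEG})\le 2\sqrt2\,\big(\sum_g\Pr(G=g)P^{\rm ph}_g\big)^{1/2}$; and $d_1(\rho^{\rm vir}_{KEG})\le 2\varepsilon'''+2^{\frac12[m-H_{\min}^{\rm th}+3]}$. -/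

import Mathlib

open scoped Matrix Kronecker ComplexOrder MatrixOrder

noncomputable section

namespace QKD

/-! ### Finite-dimensional states, norms and entropies

A system with an orthonormal basis indexed by a finite type `α` is represented by `α`;
operators are matrices, and composite systems are products of index types. -/

/-- Bit strings of length `d`, with addition modulo two. -/
abbrev Bits (d : ℕ) : Type := Fin d → ZMod 2

section States

variable {α β : Type*} [Fintype α] [DecidableEq α] [Fintype β] [DecidableEq β]

/-- The rank one projection `|i⟩⟨i|` onto a basis vector. -/
def proj {α : Type*} [DecidableEq α] (i : α) : Matrix α α ℂ := Matrix.single i i 1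

/-- The density operator `|ψ⟩⟨ψ|` of a vector. -/
def pureState {α : Type*} (ψ : α → ℂ) : Matrix α α ℂ := Matrix.vecMulVec ψ (star ψ)

/-- Partial trace over the first factor. -/
def trFst (ρ : Matrix (α × β) (α × β) ℂ) : Matrix β β ℂ :=
  fun i j => ∑ x, ρ (x, i) (x, j)

/-- Partial trace over the second factor. -/
def trSnd (ρ : Matrix (α × β) (α × β) ℂ) : Matrix α α ℂ :=
  fun i j => ∑ x, ρ (i, x) (j, x)

/-- Sub-normalized states. -/
def IsSubnormalized (ρ : Matrix α α ℂ) : Prop := ρ.PosSemidef ∧ ρ.trace.re ≤ 1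

/-- The trace norm `‖M‖₁ = Tr √(M† M)`. -/
def traceNorm (M : Matrix α α ℂ) : ℝ := (CFC.sqrt (Mᴴ * M)).trace.re

/-- Generalized fidelity of sub-normalized states. -/
def fidelity (ρ τ : Matrix α α ℂ) : ℝ :=
  traceNorm (CFC.sqrt ρ * CFC.sqrt τ) + √((1 - ρ.trace.re) * (1 - τ.trace.re))

/-- Purified distance of sub-normalized states. -/
def purifiedDistance (ρ τ : Matrix α α ℂ) : ℝ := √(1 - fidelity ρ τ ^ 2)

/-- Conditional min-entropy `H_min(ρ_AE | E)` (an extended real, `⊤` for `ρ = 0`): the largest `r`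
such that `ρ_AE ≤ 2^{-r} 1_A ⊗ σ_E` for some normalized state `σ_E`. -/
def minEntropy (ρ : Matrix (α × β) (α × β) ℂ) : EReal :=
  sSup {x | ∃ r : ℝ, x = (r : EReal) ∧ ∃ σ : Matrix β β ℂ, σ.PosSemidef ∧ σ.trace = 1 ∧
    ρ ≤ ((2 : ℝ) ^ (-r)) • ((1 : Matrix α α ℂ) ⊗ₖ σ)}

/-- Smooth conditional min-entropy `H_min^ε(ρ_AE | E)`. -/
def smoothMinEntropy (ε : ℝ) (ρ : Matrix (α × β) (α × β) ℂ) : EReal :=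
  sSup {x | ∃ τ : Matrix (α × β) (α × β) ℂ,
    IsSubnormalized τ ∧ purifiedDistance τ ρ ≤ ε ∧ x = minEntropy τ}

end States

/-- A random function `f` with values in `{0,1}^k`, where `f i` has probability `p i`, is
universal₂. -/
def IsUniversal₂ {ι X : Type*} [Fintype ι] {k : ℕ} (p : ι → ℝ) (f : ι → X → Bits k) : Prop :=
  ∀ x y, x ≠ y → ∑ i, p i * (if f i x = f i y then 1 else 0) ≤ (2 : ℝ) ^ (-(k : ℝ))

/-! ### Security measures -/

section Security

variable {m : ℕ} {E 𝒢 : Type*} [Fintype E] [DecidableEq E] [Fintype 𝒢] [DecidableEq 𝒢]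

/-- The state `∑_g Pr(G = g) |g⟩⟨g|` of the public register holding the hash function. -/
def hashState (p : 𝒢 → ℝ) : Matrix 𝒢 𝒢 ℂ := ∑ g, p g • proj g

/-- `d₁(ρ_KEG)`: distance of Alice's key from a uniform key independent of Eve. -/
def d₁ (p : 𝒢 → ℝ) (ρ : Matrix (Bits m × E × 𝒢) (Bits m × E × 𝒢) ℂ) : ℝ :=
  traceNorm (ρ - ∑ k : Bits m, ((2 : ℝ) ^ (-(m : ℝ))) •
    (proj k ⊗ₖ (trSnd (trFst ρ) ⊗ₖ hashState p)))

/-- `D₁(ρ_KK'EG)`: distance from a pair of identical uniform keys independent of Eve. -/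
def D₁ (p : 𝒢 → ℝ)
    (ρ : Matrix (Bits m × Bits m × E × 𝒢) (Bits m × Bits m × E × 𝒢) ℂ) : ℝ :=
  traceNorm (ρ - ∑ k : Bits m, ((2 : ℝ) ^ (-(m : ℝ))) •
    (proj k ⊗ₖ (proj k ⊗ₖ (trSnd (trFst (trFst ρ)) ⊗ₖ hashState p))))

end Security

/-! ### The actual QKD scheme -/

/-- Writing the public message `t` in a fresh register of Eve's system `E`. -/
def announce (E : Type*) {T : Type*} [DecidableEq E] [DecidableEq T] (t : T) : Matrix (E × T) E ℂ :=
  fun x e => if x.1 = e ∧ x.2 = t then 1 else 0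

/-- A general QKD scheme: initial state on `A'B'E`, sample measurement, sifted key measurement,
error correction and verification over a one-time-pad encrypted channel, privacy amplification.
Here `n`, `m`, `l`, `c` are the lengths of the sifted key, of the final key, of the verification
tag and of the messages sent in the error correction. -/
structure Scheme (n m l c : ℕ) (A' B' E T R I J 𝒰 𝒢 : Type*)
    [Fintype A'] [DecidableEq A'] [Fintype B'] [DecidableEq B'] [Fintype E] [DecidableEq E]
    [Fintype R] [Fintype I] [Fintype J] [Fintype 𝒰] [Fintype 𝒢] where
  /-- The initial state. -/
  ini : Matrix ((A' × B') × E) ((A' × B') × E) ℂ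
  ini_sub : IsSubnormalized ini
  /-- Sample measurement with outcomes in `R`. Arbitrary joint measurement operators are allowed;
  this contains local measurements and public discussion. -/
  smp : R → Matrix (A' × B') (A' × B') ℂ
  smp_sum : ∑ r, (smp r)ᴴ * smp r = 1
  /-- The outcomes on which the protocol is continued. -/
  accept : Finset R
  /-- The public announcement made on each outcome. -/
  ann : R → T
  /-- Alice's sifted key measurement; the outcome is the sifted key and a discarded index. -/
  sifA : Bits n → I → Matrix A' A' ℂ
  sifA_sum : ∑ a, ∑ i, (sifA a i)ᴴ * sifA a i = 1
  /-- Bob's sifted key measurement. -/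
  sifB : Bits n → J → Matrix B' B' ℂ
  sifB_sum : ∑ b, ∑ j, (sifB b j)ᴴ * sifB b j = 1
  /-- Error correction: `ec a b (w, b')` is the probability that, on sifted keys `a` and `b`,
  the plain text of the exchanged messages is `w` and Bob's corrected key is `b'`. -/
  ec : Bits n → Bits n → Bits c × Bits n → ℝ
  ec_prob : ∀ a b, ec a b ∈ stdSimplex ℝ (Bits c × Bits n)
  /-- The random verification function. -/
  pU : 𝒰 → ℝ
  pU_prob : pU ∈ stdSimplex ℝ 𝒰
  u : 𝒰 → Bits n → Bits l
  u_univ : IsUniversal₂ pU u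
  /-- The random hash function of the privacy amplification. -/
  pG : 𝒢 → ℝ
  pG_prob : pG ∈ stdSimplex ℝ 𝒢
  g : 𝒢 → Bits n →ₗ[ZMod 2] Bits m
  g_surj : ∀ i, Function.Surjective (g i)
  g_univ : IsUniversal₂ pG (fun i => ⇑(g i))

/-! ### Virtual privacy amplification with phase error correction -/

section Virtual

variable {n m : ℕ}

/-- `(-1)^{x·z}`. -/
def sign (x z : Bits n) : ℂ := (-1) ^ (x ⬝ᵥ z).val

/-- The phase basis vector `|x̃⟩ = 2^{-n/2} ∑_z (-1)^{x·z} |z⟩`. -/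
def phaseKet (x : Bits n) : Bits n → ℂ := fun z => ((2 : ℝ) ^ (-(n : ℝ) / 2) : ℝ) * sign x z

/-- The Pauli operator `Z^e`. -/
def pauliZ (e : Bits n) : Matrix (Bits n) (Bits n) ℂ := Matrix.diagonal (sign e)

/-- The Pauli operator `X^x`, i.e. `X^x |z⟩ = |z + x⟩`. -/
def pauliX (x : Bits n) : Matrix (Bits n) (Bits n) ℂ :=
  Matrix.of fun y z => if y = z + x then 1 else 0

variable {E C : Type*} [Fintype E] [DecidableEq E] [Fintype C] [DecidableEq C]

/-- Reduced state on `AE` of a pure state on `AEC`. -/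
def reducedAE (ψ : Bits n × E × C → ℂ) : Matrix (Bits n × E) (Bits n × E) ℂ :=
  fun x y => ∑ z, pureState ψ (x.1, x.2, z) (y.1, y.2, z)

/-- Measurement of `A` in the `Z` basis (erasure of the off-diagonal blocks). -/
def zMeasure (ρ : Matrix (Bits n × E) (Bits n × E) ℂ) : Matrix (Bits n × E) (Bits n × E) ℂ :=
  ∑ z : Bits n, (proj z ⊗ₖ (1 : Matrix E E ℂ)) * ρ * (proj z ⊗ₖ (1 : Matrix E E ℂ))

def IsPurification (ψ : Bits n × E × C → ℂ) (ρ : Matrix (Bits n × E) (Bits n × E) ℂ) : Prop :=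
  reducedAE ψ = ρ

def IsSemiPurification (ψ : Bits n × E × C → ℂ) (ρ : Matrix (Bits n × E) (Bits n × E) ℂ) :
    Prop :=
  zMeasure (reducedAE ψ) = ρ

/-- Twirling: a fresh `n`-qubit ancilla `|0⟩` is added and `∑_z |z⟩⟨z|_A ⊗ X^z` is applied. -/
def twirl (ψ : Bits n × E × C → ℂ) : Bits n × E × (C × Bits n) → ℂ :=
  fun x => pauliX x.1 x.2.2.2 0 * ψ (x.1, x.2.1, x.2.2.1)

/-- `h` is a check matrix of the code generated by the rows of the matrix of `g`. -/
def IsCheckMatrix (g : Bits n →ₗ[ZMod 2] Bits m) (h : Matrix (Fin (n - m)) (Fin n) (ZMod 2)) :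
    Prop :=
  LinearIndependent (ZMod 2) h.row ∧ h * (LinearMap.toMatrix' g)ᵀ = 0

/-- Projection onto the joint eigenspace of `X^{h_1}, …, X^{h_{n-m}}` with syndrome `s`, i.e.
onto the span of the phase basis vectors `|x̃⟩` with `h x = s`. -/
def syndromeProj (h : Matrix (Fin (n - m)) (Fin n) (ZMod 2)) (s : Bits (n - m)) :
    Matrix (Bits n) (Bits n) ℂ :=
  ∑ x : Bits n, if h *ᵥ x = s then pureState (phaseKet x) else 0

/-- Phase error correction: measure the syndrome `s` on `A`, measure the ancilla `C` with the
operators `M s e`, and flip phases by `Z^e`. -/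
def pec (h : Matrix (Fin (n - m)) (Fin n) (ZMod 2)) (M : Bits (n - m) → Bits n → Matrix C C ℂ)
    (ρ : Matrix (Bits n × E × C) (Bits n × E × C) ℂ) :
    Matrix (Bits n × E × C) (Bits n × E × C) ℂ :=
  ∑ s, ∑ e, ((pauliZ e * syndromeProj h s) ⊗ₖ ((1 : Matrix E E ℂ) ⊗ₖ M s e)) * ρ *
    ((pauliZ e * syndromeProj h s) ⊗ₖ ((1 : Matrix E E ℂ) ⊗ₖ M s e))ᴴ

/-- The phase error probability `1 - ⟨0̃|ρ_A|0̃⟩` of `A`. -/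
def phaseError (ρ : Matrix (Bits n × E × C) (Bits n × E × C) ℂ) : ℝ :=
  1 - (star (phaseKet 0) ⬝ᵥ (trSnd ρ *ᵥ phaseKet 0)).re

/-- Projection of `A` onto the strings with hash value `k`: the joint eigenspace of
`Z^{g_1}, …, Z^{g_m}` with eigenvalues `(-1)^{k_i}`. -/
def bitProj (g : Bits n →ₗ[ZMod 2] Bits m) (k : Bits m) : Matrix (Bits n) (Bits n) ℂ :=
  Matrix.diagonal fun a => if g a = k then 1 else 0

/-- Bit basis measurement, storing the hash value in `K`, reduced to `KE`. -/
def bitMeasure (g : Bits n →ₗ[ZMod 2] Bits m)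
    (ρ : Matrix (Bits n × E × C) (Bits n × E × C) ℂ) : Matrix (Bits m × E) (Bits m × E) ℂ :=
  ∑ k, proj k ⊗ₖ trSnd (trFst
    ((bitProj g k ⊗ₖ (1 : Matrix (E × C) (E × C) ℂ)) * ρ *
      (bitProj g k ⊗ₖ (1 : Matrix (E × C) (E × C) ℂ))))

end Virtual

namespace Scheme

variable {n m l c : ℕ} {A' B' E T R I J 𝒰 𝒢 : Type*}
  [Fintype A'] [DecidableEq A'] [Fintype B'] [DecidableEq B'] [Fintype E] [DecidableEq E]
  [Fintype T] [DecidableEq T] [Fintype R] [DecidableEq R] [Fintype I] [Fintype J]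
  [Fintype 𝒰] [DecidableEq 𝒰] [Fintype 𝒢] [DecidableEq 𝒢]
  (S : Scheme n m l c A' B' E T R I J 𝒰 𝒢)

/-- The sub-normalized state after the sample measurement (protocol continued). Eve holds `E`
and the announcement. -/
def sampled : Matrix ((A' × B') × (E × T)) ((A' × B') × (E × T)) ℂ :=
  ∑ r ∈ S.accept,
    (S.smp r ⊗ₖ announce E (S.ann r)) * S.ini * (S.smp r ⊗ₖ announce E (S.ann r))ᴴ

/-- Eve's sub-normalized state when the sifted keys are `a` and `b`. -/
def siftedBlock (a b : Bits n) : Matrix (E × T) (E × T) ℂ :=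
  trFst (∑ i, ∑ j, ((S.sifA a i ⊗ₖ S.sifB b j) ⊗ₖ (1 : Matrix (E × T) (E × T) ℂ)) * S.sampled *
    ((S.sifA a i ⊗ₖ S.sifB b j) ⊗ₖ (1 : Matrix (E × T) (E × T) ℂ))ᴴ)

/-- The state `ρ_AE^sif` of Alice's sifted key and Eve. -/
def siftedAE : Matrix (Bits n × (E × T)) (Bits n × (E × T)) ℂ :=
  ∑ a, ∑ b, proj a ⊗ₖ S.siftedBlock a b

/-- The part of the final state `ρ_KK'EG` in which the outcome of the verification is `ok`.
Besides `E` and the announcement, Eve holds the verification function and the cipher texts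
`w + x` and `u(a) + y` of the error correction messages `w` and of the verification tag `u(a)`;
`x` and `y` are uniform secret one-time-pad keys. -/
def finalBranch (ok : Bool) :
    Matrix (Bits m × Bits m × ((E × T) × (𝒰 × Bits c × Bits l)) × 𝒢)
      (Bits m × Bits m × ((E × T) × (𝒰 × Bits c × Bits l)) × 𝒢) ℂ :=
  ∑ g, ∑ u, ∑ a, ∑ b, ∑ w, ∑ b', ∑ x : Bits c, ∑ y : Bits l,
    (S.pG g * S.pU u * S.ec a b (w, b') * (2 : ℝ) ^ (-(c : ℝ)) * (2 : ℝ) ^ (-(l : ℝ)) *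
      (if decide (S.u u a = S.u u b') = ok then 1 else 0)) •
    (proj (S.g g a) ⊗ₖ (proj (S.g g b') ⊗ₖ
      ((S.siftedBlock a b ⊗ₖ (proj u ⊗ₖ (proj (w + x) ⊗ₖ proj (S.u u a + y)))) ⊗ₖ proj g)))

/-- The final sub-normalized state `ρ_KK'EG^fin`: the verification has succeeded. -/
def final : Matrix (Bits m × Bits m × ((E × T) × (𝒰 × Bits c × Bits l)) × 𝒢)
      (Bits m × Bits m × ((E × T) × (𝒰 × Bits c × Bits l)) × 𝒢) ℂ :=
  S.finalBranch true

/-- Reduced state of Alice's final key, Eve's system `E` with the announcement, and `G`,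
irrespective of what Bob does: both outcomes of the verification are kept, and `K'` and the
registers written during the information reconciliation are traced out. -/
def finalAlice : Matrix (Bits m × (E × T) × 𝒢) (Bits m × (E × T) × 𝒢) ℂ :=
  fun p q => ∑ k', ∑ z,
    (S.finalBranch true + S.finalBranch false)
      (p.1, k', (p.2.1, z), p.2.2) (q.1, k', (q.2.1, z), q.2.2)

/-- The pure state prepared in the virtual schemes from a purification `ψ` of the initial state
with ancilla `P`: the sample measurement and Alice's sifted key measurement are carried out
coherently (by isometries that record the outcomes in ancillas), and the outcomes of the sample
measurement are projected onto the accepted ones. -/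
def prepared {P : Type*} (ψ : ((A' × B') × E) × P → ℂ) :
    Bits n × (E × T) × ((A' × B') × P × R × I) → ℂ :=
  fun (a, (e, t), (z, p, r, i)) =>
    if r ∈ S.accept ∧ t = S.ann r then
      ∑ z', ((S.sifA a i ⊗ₖ (1 : Matrix B' B' ℂ)) * S.smp r) z z' * ψ ((z', e), p)
    else 0

/-- The final state on `KEG` of the virtual scheme with twirling and phase error correction,
run on the prepared state `φ`, with check matrices `h` and ancilla measurements `M`. -/
def virtualFinal {C : Type*} [Fintype C] [DecidableEq C]
    (h : 𝒢 → Matrix (Fin (n - m)) (Fin n) (ZMod 2))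
    (M : 𝒢 → Bits (n - m) → Bits n → Matrix (C × Bits n) (C × Bits n) ℂ)
    (φ : Bits n × (E × T) × C → ℂ) :
    Matrix (Bits m × (E × T) × 𝒢) (Bits m × (E × T) × 𝒢) ℂ :=
  (∑ g, S.pG g • (bitMeasure (S.g g) (pec (h g) (M g) (pureState (twirl φ))) ⊗ₖ proj g)).submatrix
    (Equiv.prodAssoc _ _ _).symm (Equiv.prodAssoc _ _ _).symm

end Scheme

end QKD

end

/-!
For a random linear map `g`, universality makes the deviations `Pr(g v = 0) - 2^{-m}` nonpositive
for `v ≠ 0`, and they sum to zero, so their absolute sum is at most `2`; Cauchy–Schwarz turns this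
into the leftover hash bound for a state whose min-entropy is known. Smoothing transfers the bound
to a real state: by Uhlmann's theorem its square root splits into a part dominated by the smoothed
state and a remainder of norm at most `ε`, and the remainder costs at most `2ε`. The one-time pads
make the cipher texts independent of `a` and `b`, so the protocol hands Eve nothing that privacy
amplification does not already cover, and the verification misses `a ≠ b` with weight at most
`2^{-l}`, which costs `2 · 2^{-l}` in trace norm.

In the virtual scheme, twirling copies the key into `T`, which makes the vector a purification. The
corrections `Z^e` and, since `h gᵀ = 0`, the syndrome projections commute with the `Z^{gᵢ}`, so
error correction leaves the joint state of key and Eve unchanged. Finally, on `|0̃⟩` every hash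
value is equally likely and independent of Eve, so the gentle measurement bound for the projection
onto `|0̃⟩` controls `d₁` by the phase error probability.
-/

noncomputable section

namespace QKD

section Contraction

variable {α β γ : Type*}

/-- Matrices of operator norm at most one. -/
def IsContraction [Fintype α] [DecidableEq β] (U : Matrix α β ℂ) : Prop := Uᴴ * U ≤ 1

lemma conjTranspose_mul_mul_mono [Fintype α] [Finite β] {A B : Matrix α α ℂ} (h : A ≤ B)
    (C : Matrix α β ℂ) : Cᴴ * A * C ≤ Cᴴ * B * C := by
  rw [Matrix.le_iff, ← Matrix.sub_mul, ← Matrix.mul_sub]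
  exact h.conjTranspose_mul_mul_same C

lemma isContraction_one [Fintype α] [DecidableEq α] : IsContraction (1 : Matrix α α ℂ) := by
  simp [IsContraction]

namespace IsContraction

lemma neg [Fintype α] [DecidableEq β] {U : Matrix α β ℂ} (hU : IsContraction U) :
    IsContraction (-U) := by
  simpa [IsContraction] using hU

lemma mul [Fintype α] [Fintype β] [DecidableEq β] [Finite γ] [DecidableEq γ] {U : Matrix α β ℂ}
    {V : Matrix β γ ℂ} (hU : IsContraction U) (hV : IsContraction V) : IsContraction (U * V) :=
  calc (U * V)ᴴ * (U * V) = Vᴴ * (Uᴴ * U) * V := by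
        simp only [Matrix.conjTranspose_mul, Matrix.mul_assoc]
    _ ≤ Vᴴ * 1 * V := conjTranspose_mul_mul_mono hU V
    _ = Vᴴ * V := by rw [Matrix.mul_one]
    _ ≤ 1 := hV

lemma conjTranspose [Fintype α] [DecidableEq α] [Fintype β] [DecidableEq β] {U : Matrix α β ℂ}
    (hU : IsContraction U) : IsContraction Uᴴ := by
  have hsplit : 1 - U * Uᴴ = (1 - U * Uᴴ) * (1 - U * Uᴴ)ᴴ + U * (1 - Uᴴ * U) * Uᴴ := by
    simp only [Matrix.conjTranspose_sub, Matrix.conjTranspose_one, Matrix.conjTranspose_mul,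
      Matrix.conjTranspose_conjTranspose, Matrix.mul_sub, Matrix.sub_mul, Matrix.mul_one,
      Matrix.one_mul, Matrix.mul_assoc]
    abel
  rw [IsContraction, Matrix.conjTranspose_conjTranspose, Matrix.le_iff, hsplit]
  exact (Matrix.posSemidef_self_mul_conjTranspose _).add (hU.mul_mul_conjTranspose_same U)

lemma submatrix [Fintype α] [DecidableEq α] [Fintype β] [DecidableEq β] {U : Matrix α α ℂ}
    (hU : IsContraction U) {f : β → α} (hf : Function.Injective f) :
    IsContraction (U.submatrix f f) := by
  have hJ : IsContraction ((1 : Matrix α α ℂ).submatrix id f) := by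
    rw [IsContraction, Matrix.conjTranspose_submatrix, Matrix.conjTranspose_one,
      ← Matrix.submatrix_mul _ _ f id f Function.bijective_id, Matrix.one_mul,
      Matrix.submatrix_one f hf]
  have hU_eq : U.submatrix f f =
      ((1 : Matrix α α ℂ).submatrix id f)ᴴ * U * (1 : Matrix α α ℂ).submatrix id f := by
    ext i j
    simp [Matrix.mul_apply, Matrix.one_apply]
  rw [hU_eq]
  exact (hJ.conjTranspose.mul hU).mul hJ

lemma kronecker [Fintype α] [DecidableEq α] [Fintype β] [DecidableEq β] {U : Matrix α α ℂ}
    {V : Matrix β β ℂ} (hU : IsContraction U) (hV : IsContraction V) : IsContraction (U ⊗ₖ V) := by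
  have hU' : IsContraction (U ⊗ₖ (1 : Matrix β β ℂ)) := by
    have hsub : (1 : Matrix (α × β) (α × β) ℂ) - (Uᴴ * U) ⊗ₖ 1 = (1 - Uᴴ * U) ⊗ₖ 1 := by
      rw [sub_eq_iff_eq_add, ← Matrix.add_kronecker, sub_add_cancel, Matrix.one_kronecker_one]
    rw [IsContraction, Matrix.conjTranspose_kronecker, ← Matrix.mul_kronecker_mul, Matrix.le_iff,
      Matrix.conjTranspose_one, Matrix.one_mul, hsub]
    exact Matrix.PosSemidef.kronecker hU Matrix.PosSemidef.one
  have hV' : IsContraction ((1 : Matrix α α ℂ) ⊗ₖ V) := by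
    have hsub : (1 : Matrix (α × β) (α × β) ℂ) - 1 ⊗ₖ (Vᴴ * V) = 1 ⊗ₖ (1 - Vᴴ * V) := by
      rw [sub_eq_iff_eq_add, ← Matrix.kronecker_add, sub_add_cancel, Matrix.one_kronecker_one]
    rw [IsContraction, Matrix.conjTranspose_kronecker, ← Matrix.mul_kronecker_mul, Matrix.le_iff,
      Matrix.conjTranspose_one, Matrix.one_mul, hsub]
    exact Matrix.PosSemidef.kronecker Matrix.PosSemidef.one hV
  simpa [← Matrix.mul_kronecker_mul] using hU'.mul hV'

lemma sum_smul {ι : Type*} [Fintype ι] [Fintype α] [Finite β] [DecidableEq β] {p : ι → ℝ}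
    (hp : p ∈ stdSimplex ℝ ι) {V : ι → Matrix α β ℂ} (hV : ∀ i, IsContraction (V i)) :
    IsContraction (∑ i, p i • V i) := by
  have := Fintype.ofFinite β
  set W := ∑ i, p i • V i with hW
  have hvar : (∑ i, p i • ((V i)ᴴ * V i)) - Wᴴ * W = ∑ i, p i • ((V i - W)ᴴ * (V i - W)) := by
    have hWV : ∑ i, p i • (Wᴴ * V i) = Wᴴ * W := by
      simp only [← Matrix.mul_smul, ← Matrix.mul_sum, ← hW]
    have hVW : ∑ i, p i • ((V i)ᴴ * W) = Wᴴ * W := by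
      simp only [← Matrix.smul_mul, ← Matrix.sum_mul]
      rw [hW, Matrix.conjTranspose_sum]
      simp only [Matrix.conjTranspose_smul, star_trivial]
    simp only [Matrix.conjTranspose_sub, Matrix.sub_mul, Matrix.mul_sub, smul_sub,
      Finset.sum_sub_distrib, hWV, hVW, ← Finset.sum_smul, hp.2]
    module
  have hsecond : ∑ i, p i • ((V i)ᴴ * V i) ≤ 1 := by
    calc ∑ i, p i • ((V i)ᴴ * V i) ≤ ∑ i, p i • (1 : Matrix β β ℂ) :=
          Finset.sum_le_sum fun i _ => smul_le_smul_of_nonneg_left (hV i) (hp.1 i)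
      _ = 1 := by rw [← Finset.sum_smul, hp.2, one_smul]
  refine le_trans (sub_nonneg.1 ?_) hsecond
  rw [hvar]
  exact Finset.sum_nonneg fun i _ => smul_nonneg (hp.1 i)
    (Matrix.posSemidef_conjTranspose_mul_self _).nonneg

end IsContraction

lemma exists_pseudoinverse [Fintype α] {P : Matrix α α ℂ} (hP : P.IsHermitian) :
    ∃ G : Matrix α α ℂ, G.IsHermitian ∧ P * G * P = P ∧ G * P * G = G := by
  classical
  have hsa : IsSelfAdjoint P := hP
  have hcfc_mul (f g : ℝ → ℝ) : cfc f P * cfc g P = cfc (fun x => f x * g x) P :=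
    (cfc_mul f g P (P.finite_real_spectrum.continuousOn f)
      (P.finite_real_spectrum.continuousOn g)).symm
  have hid : cfc (fun x : ℝ => x) P = P := cfc_id' ℝ P
  refine ⟨cfc (fun x : ℝ => x⁻¹) P, cfc_predicate _ P, ?_, ?_⟩
  · calc P * cfc (fun x : ℝ => x⁻¹) P * P = cfc (fun x : ℝ => x * x⁻¹ * x) P := by
          nth_rw 1 3 [← hid]
          rw [hcfc_mul, hcfc_mul]
      _ = P := by simp only [mul_inv_mul_cancel, hid]
  · calc cfc (fun x : ℝ => x⁻¹) P * P * cfc (fun x : ℝ => x⁻¹) P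
          = cfc (fun x : ℝ => x⁻¹ * x * x⁻¹) P := by
          nth_rw 2 [← hid]
          rw [hcfc_mul, hcfc_mul]
      _ = cfc (fun x : ℝ => x⁻¹) P := by
        congr 1
        funext x
        simpa only [inv_inv] using mul_inv_mul_cancel x⁻¹

/-- **Douglas' factorization lemma** -/
lemma exists_contraction_mul_of_conjTranspose_mul_self_le [Fintype α] [Fintype β] [DecidableEq β]
    [Finite γ] {A : Matrix α γ ℂ} {B : Matrix β γ ℂ} (h : Aᴴ * A ≤ Bᴴ * B) :
    ∃ K : Matrix α β ℂ, IsContraction K ∧ A = K * B := by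
  classical
  have := Fintype.ofFinite γ
  obtain ⟨G, hG, hPGP, hGPG⟩ := exists_pseudoinverse (Matrix.isHermitian_conjTranspose_mul_self B)
  have hproj : IsStarProjection (B * G * Bᴴ) := by
    refine ⟨?_, ?_⟩
    · calc B * G * Bᴴ * (B * G * Bᴴ) = B * (G * (Bᴴ * B) * G) * Bᴴ := by
            simp only [Matrix.mul_assoc]
        _ = B * G * Bᴴ := by rw [hGPG]
    · simp [IsSelfAdjoint, Matrix.star_eq_conjTranspose, Matrix.conjTranspose_mul, hG.eq,
        Matrix.mul_assoc]
  have hker : A * (1 - G * (Bᴴ * B)) = 0 := by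
    rw [← Matrix.conjTranspose_mul_self_eq_zero]
    set Q := 1 - G * (Bᴴ * B)
    have hPQ : Bᴴ * B * Q = 0 := by
      rw [Matrix.mul_sub, ← Matrix.mul_assoc, hPGP, Matrix.mul_one, sub_self]
    refine le_antisymm ?_ (Matrix.posSemidef_conjTranspose_mul_self _).nonneg
    calc (A * Q)ᴴ * (A * Q) = Qᴴ * (Aᴴ * A) * Q := by
          simp only [Matrix.conjTranspose_mul, Matrix.mul_assoc]
      _ ≤ Qᴴ * (Bᴴ * B) * Q := conjTranspose_mul_mul_mono h Q
      _ = 0 := by rw [Matrix.mul_assoc, hPQ, Matrix.mul_zero]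
  refine ⟨A * G * Bᴴ, ?_, ?_⟩
  · calc (A * G * Bᴴ)ᴴ * (A * G * Bᴴ) = (G * Bᴴ)ᴴ * (Aᴴ * A) * (G * Bᴴ) := by
          simp only [Matrix.conjTranspose_mul, Matrix.mul_assoc]
      _ ≤ (G * Bᴴ)ᴴ * (Bᴴ * B) * (G * Bᴴ) := conjTranspose_mul_mul_mono h _
      _ = B * (G * (Bᴴ * B) * G) * Bᴴ := by
          simp only [Matrix.conjTranspose_mul, Matrix.conjTranspose_conjTranspose, hG.eq,
            Matrix.mul_assoc]
      _ ≤ 1 := by rw [hGPG]; exact hproj.le_one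
  · rw [Matrix.mul_sub, Matrix.mul_one, sub_eq_zero] at hker
    simpa only [Matrix.mul_assoc] using hker

end Contraction

section TraceNorm

variable {α : Type*} [Fintype α] [DecidableEq α]

lemma isHermitian_sqrt (A : Matrix α α ℂ) : (CFC.sqrt A).IsHermitian :=
  IsSelfAdjoint.of_nonneg (CFC.sqrt_nonneg A)

lemma conjTranspose_sqrt_mul_sqrt {A : Matrix α α ℂ} (hA : A.PosSemidef) :
    (CFC.sqrt A)ᴴ * CFC.sqrt A = A := by
  rw [(isHermitian_sqrt A).eq, CFC.sqrt_mul_sqrt_self A hA.nonneg]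

lemma exists_contraction_re_trace_mul_eq_traceNorm (M : Matrix α α ℂ) :
    ∃ U : Matrix α α ℂ, IsContraction U ∧ (U * M).trace.re = traceNorm M := by
  have hS := conjTranspose_sqrt_mul_sqrt (Matrix.posSemidef_conjTranspose_mul_self M)
  obtain ⟨U, hU, hUM⟩ := exists_contraction_mul_of_conjTranspose_mul_self_le hS.le
  exact ⟨U, hU, by rw [← hUM, traceNorm]⟩

lemma traceNorm_le {M : Matrix α α ℂ} {C : ℝ}
    (h : ∀ U : Matrix α α ℂ, IsContraction U → (U * M).trace.re ≤ C) : traceNorm M ≤ C := by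
  obtain ⟨U, hU, hUM⟩ := exists_contraction_re_trace_mul_eq_traceNorm M
  exact hUM ▸ h U hU

end TraceNorm

section HilbertSchmidt

open scoped Matrix.Norms.Frobenius

variable {α β γ : Type*} [Fintype α] [Fintype β]

lemma frobenius_norm_eq_sqrt (A : Matrix α β ℂ) : ‖A‖ = √(∑ x : α × β, ‖A x.1 x.2‖ ^ 2) := by
  simp [Matrix.frobenius_norm_def, Real.sqrt_eq_rpow, Fintype.sum_prod_type]

lemma frobenius_norm_sq (A : Matrix α β ℂ) : ‖A‖ ^ 2 = (Aᴴ * A).trace.re := by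
  rw [frobenius_norm_eq_sqrt, Real.sq_sqrt (by positivity), Fintype.sum_prod_type_right]
  simp [Matrix.trace, Matrix.mul_apply, Complex.conj_mul', ← Complex.ofReal_pow]

lemma frobenius_norm_sq' (A : Matrix α β ℂ) : ‖A‖ ^ 2 = (A * Aᴴ).trace.re := by
  rw [frobenius_norm_sq, Matrix.trace_mul_comm]

lemma abs_re_trace_mul_le (A : Matrix α β ℂ) (B : Matrix β α ℂ) :
    |(A * B).trace.re| ≤ ‖A‖ * ‖B‖ :=
  calc |(A * B).trace.re| ≤ ‖(A * B).trace‖ := Complex.abs_re_le_norm _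
    _ = ‖∑ x : α × β, A x.1 x.2 * B x.2 x.1‖ := by
      simp [Matrix.trace, Matrix.mul_apply, Fintype.sum_prod_type]
    _ ≤ ∑ x : α × β, ‖A x.1 x.2‖ * ‖B x.2 x.1‖ :=
      norm_sum_le_of_le _ fun x _ => (norm_mul _ _).le
    _ ≤ √(∑ x : α × β, ‖A x.1 x.2‖ ^ 2) * √(∑ x : α × β, ‖B x.2 x.1‖ ^ 2) :=
      Real.sum_mul_le_sqrt_mul_sqrt _ _ _
    _ = ‖A‖ * ‖B‖ := by
      rw [frobenius_norm_eq_sqrt, frobenius_norm_eq_sqrt, ← (Equiv.prodComm α β).sum_comp]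
      rfl

lemma re_trace_conjTranspose (A : Matrix α α ℂ) : Aᴴ.trace.re = A.trace.re := by
  simp [Matrix.trace_conjTranspose]

lemma frobenius_norm_sub_smul_sq (A B : Matrix α β ℂ) (c : ℝ) :
    ‖A - c • B‖ ^ 2 = ‖A‖ ^ 2 - 2 * c * (Aᴴ * B).trace.re + c ^ 2 * ‖B‖ ^ 2 := by
  have hflip : (Bᴴ * A).trace.re = (Aᴴ * B).trace.re := by
    rw [← re_trace_conjTranspose, Matrix.conjTranspose_mul, Matrix.conjTranspose_conjTranspose]
  simp only [frobenius_norm_sq, Matrix.conjTranspose_sub, Matrix.conjTranspose_smul, star_trivial,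
    Matrix.sub_mul, Matrix.mul_sub, Matrix.smul_mul, Matrix.mul_smul, Matrix.trace_sub,
    Matrix.trace_smul, Complex.sub_re, Complex.smul_re, smul_eq_mul, hflip]
  ring

lemma re_trace_nonneg {A : Matrix α α ℂ} (hA : A.PosSemidef) : 0 ≤ A.trace.re :=
  (Complex.le_def.1 hA.trace_nonneg).1

lemma re_trace_mono {A B : Matrix α α ℂ} (h : A ≤ B) : A.trace.re ≤ B.trace.re := by
  simpa using re_trace_nonneg (Matrix.le_iff.1 h)

lemma IsContraction.norm_mul_le [Fintype γ] [DecidableEq β] {U : Matrix α β ℂ}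
    (hU : IsContraction U) (A : Matrix β γ ℂ) : ‖U * A‖ ≤ ‖A‖ := by
  rw [← sq_le_sq₀ (norm_nonneg _) (norm_nonneg _), frobenius_norm_sq, frobenius_norm_sq]
  refine re_trace_mono ?_
  calc (U * A)ᴴ * (U * A) = Aᴴ * (Uᴴ * U) * A := by
        simp only [Matrix.conjTranspose_mul, Matrix.mul_assoc]
    _ ≤ Aᴴ * 1 * A := conjTranspose_mul_mul_mono hU A
    _ = Aᴴ * A := by rw [Matrix.mul_one]

lemma IsContraction.norm_mul_le' [Fintype γ] [DecidableEq γ] {U : Matrix β γ ℂ}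
    (hU : IsContraction U) (A : Matrix α β ℂ) : ‖A * U‖ ≤ ‖A‖ := by
  classical
  rw [← Matrix.frobenius_norm_conjTranspose (A * U), Matrix.conjTranspose_mul,
    ← Matrix.frobenius_norm_conjTranspose A]
  exact hU.conjTranspose.norm_mul_le Aᴴ

lemma IsContraction.re_trace_mul_mul_le [DecidableEq α] {U : Matrix α α ℂ} (hU : IsContraction U)
    (A : Matrix α β ℂ) (B : Matrix β α ℂ) : (U * (A * B)).trace.re ≤ ‖A‖ * ‖B‖ := by
  rw [← Matrix.mul_assoc]
  refine (le_abs_self _).trans ((abs_re_trace_mul_le _ _).trans ?_)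
  gcongr
  exact hU.norm_mul_le A

lemma IsContraction.abs_re_trace_mul_le [DecidableEq α] {U : Matrix α α ℂ} (hU : IsContraction U)
    {X : Matrix α α ℂ} (hX : X.PosSemidef) : |(U * X).trace.re| ≤ X.trace.re := by
  have hle {U : Matrix α α ℂ} (hU : IsContraction U) : (U * X).trace.re ≤ X.trace.re := by
    set L := CFC.sqrt X
    have hL : Lᴴ * L = X := conjTranspose_sqrt_mul_sqrt hX
    calc (U * X).trace.re = (U * (Lᴴ * L)).trace.re := by rw [hL]
      _ ≤ ‖Lᴴ‖ * ‖L‖ := hU.re_trace_mul_mul_le Lᴴ L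
      _ = X.trace.re := by
        rw [Matrix.frobenius_norm_conjTranspose, ← sq, frobenius_norm_sq, hL]
  exact abs_le'.2 ⟨hle hU, by simpa using hle hU.neg⟩

end HilbertSchmidt

section Bits

variable {n m : ℕ}

lemma card_bits (d : ℕ) : Fintype.card (Bits d) = 2 ^ d := by
  simp [Fintype.card_pi]

lemma two_rpow_neg_mul_two_pow (d : ℕ) : (2 : ℝ) ^ (-(d : ℝ)) * 2 ^ d = 1 := by
  rw [Real.rpow_neg zero_le_two, Real.rpow_natCast]
  exact inv_mul_cancel₀ (by positivity)

lemma sum_bits_two_rpow_neg (d : ℕ) : ∑ _k : Bits d, (2 : ℝ) ^ (-(d : ℝ)) = 1 := by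
  rw [Finset.sum_const, Finset.card_univ, card_bits, nsmul_eq_mul, mul_comm]
  exact_mod_cast two_rpow_neg_mul_two_pow d

lemma two_rpow_neg_le_one (d : ℕ) : (2 : ℝ) ^ (-(d : ℝ)) ≤ 1 :=
  Real.rpow_le_one_of_one_le_of_nonpos one_le_two (by simp)

lemma sum_indicator_fiber_eq (g : Bits n →ₗ[ZMod 2] Bits m) (hg : Function.Surjective g)
    (k : Bits m) : ∑ a, (if g a = k then (1 : ℝ) else 0) = 2 ^ n * (2 : ℝ) ^ (-(m : ℝ)) := by
  have hfiber (k' : Bits m) :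
      ∑ a, (if g a = k' then (1 : ℝ) else 0) = ∑ a, (if g a = k then (1 : ℝ) else 0) := by
    obtain ⟨x, hx⟩ := hg (k' - k)
    rw [← Equiv.sum_comp (Equiv.addRight x)]
    simp [hx, ← eq_sub_iff_add_eq]
  have htotal : 2 ^ m * ∑ a, (if g a = k then (1 : ℝ) else 0) = 2 ^ n :=
    calc 2 ^ m * ∑ a, (if g a = k then (1 : ℝ) else 0)
        = ∑ k' : Bits m, ∑ a, (if g a = k' then (1 : ℝ) else 0) := by
          simp [hfiber]
      _ = 2 ^ n := by
          rw [Finset.sum_comm]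
          simp
  rw [← htotal]
  linear_combination -(∑ a, (if g a = k then (1 : ℝ) else 0)) * two_rpow_neg_mul_two_pow m

end Bits

section Universal

variable {n m : ℕ} {𝒢 : Type*} [Fintype 𝒢]

/-- The deviation of the indicator of `g a = k` from the uniform distribution of `k`. -/
def hashDev (g : Bits n →ₗ[ZMod 2] Bits m) (k : Bits m) (a : Bits n) : ℝ :=
  (if g a = k then 1 else 0) - (2 : ℝ) ^ (-(m : ℝ))

/-- The deviation of the probability of `g v = 0`, for a random linear map `g`, from `2^{-m}`. -/
def collisionDev (p : 𝒢 → ℝ) (g : 𝒢 → Bits n →ₗ[ZMod 2] Bits m) (v : Bits n) : ℝ :=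
  ∑ i, p i * (if g i v = 0 then 1 else 0) - (2 : ℝ) ^ (-(m : ℝ))

lemma sum_hashDev_mul_hashDev (g : Bits n →ₗ[ZMod 2] Bits m) (a b : Bits n) :
    ∑ k, hashDev g k a * hashDev g k b =
      (if g (a - b) = 0 then 1 else 0) - (2 : ℝ) ^ (-(m : ℝ)) := by
  simp only [hashDev, sub_mul, mul_sub, Finset.sum_sub_distrib, ← Finset.sum_mul,
    ← Finset.mul_sum, sum_bits_two_rpow_neg]
  simp [sub_eq_zero, eq_comm (b := g b)]

lemma sum_mul_sum_hashDev_mul_hashDev {p : 𝒢 → ℝ} (hp : p ∈ stdSimplex ℝ 𝒢)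
    (g : 𝒢 → Bits n →ₗ[ZMod 2] Bits m) (a b : Bits n) :
    ∑ i, p i * ∑ k, hashDev (g i) k a * hashDev (g i) k b = collisionDev p g (a - b) := by
  simp only [sum_hashDev_mul_hashDev, collisionDev, mul_sub, Finset.sum_sub_distrib,
    ← Finset.sum_mul, hp.2, one_mul]

lemma sum_collisionDev {p : 𝒢 → ℝ} (hp : p ∈ stdSimplex ℝ 𝒢)
    {g : 𝒢 → Bits n →ₗ[ZMod 2] Bits m} (hg : ∀ i, Function.Surjective (g i)) :
    ∑ v, collisionDev p g v = 0 := by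
  simp only [collisionDev, Finset.sum_sub_distrib]
  rw [Finset.sum_comm]
  simp only [← Finset.mul_sum, sum_indicator_fiber_eq _ (hg _), ← Finset.sum_mul, hp.2, one_mul]
  simp

lemma sum_abs_collisionDev_le {p : 𝒢 → ℝ} (hp : p ∈ stdSimplex ℝ 𝒢)
    {g : 𝒢 → Bits n →ₗ[ZMod 2] Bits m} (hg : ∀ i, Function.Surjective (g i))
    (hu : IsUniversal₂ p (fun i => ⇑(g i))) : ∑ v, |collisionDev p g v| ≤ 2 := by
  have hzero : collisionDev p g 0 = 1 - (2 : ℝ) ^ (-(m : ℝ)) := by simp [collisionDev, hp.2]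
  have hpos : 0 ≤ collisionDev p g 0 := hzero ▸ sub_nonneg.2 (two_rpow_neg_le_one m)
  have hneg (v : Bits n) (hv : v ≠ 0) : collisionDev p g v ≤ 0 := by
    simpa [collisionDev] using hu v 0 hv
  have habs (v : Bits n) : |collisionDev p g v| =
      (if v = 0 then 2 * collisionDev p g 0 else 0) - collisionDev p g v := by
    split_ifs with hv
    · rw [hv, abs_of_nonneg hpos]
      ring
    · rw [abs_of_nonpos (hneg v hv), zero_sub]
  calc ∑ v, |collisionDev p g v| = 2 * collisionDev p g 0 := by
        simp [habs, Finset.sum_sub_distrib, sum_collisionDev hp hg]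
    _ ≤ 2 := by
      rw [hzero]
      linarith [Real.rpow_nonneg zero_le_two (-(m : ℝ))]

lemma sum_sub_mul_le_of_abs_le {V : Type*} [AddCommGroup V] [Fintype V] (Q : V → ℝ)
    {r : V → V → ℝ} {t : V → ℝ} (hr : ∀ a b, |r a b| ≤ t a * t b) :
    ∑ a, ∑ b, Q (a - b) * r a b ≤ (∑ v, |Q v|) * ∑ a, t a ^ 2 := by
  have hterm (a b : V) :
      Q (a - b) * r a b ≤ |Q (a - b)| * t a ^ 2 / 2 + |Q (a - b)| * t b ^ 2 / 2 :=
    calc Q (a - b) * r a b ≤ |Q (a - b)| * |r a b| := by rw [← abs_mul]; exact le_abs_self _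
      _ ≤ |Q (a - b)| * ((t a ^ 2 + t b ^ 2) / 2) := by
        gcongr
        exact (hr a b).trans (by linarith [two_mul_le_add_sq (t a) (t b)])
      _ = |Q (a - b)| * t a ^ 2 / 2 + |Q (a - b)| * t b ^ 2 / 2 := by ring
  have hleft (a : V) : ∑ b, |Q (a - b)| = ∑ v, |Q v| := (Equiv.subLeft a).sum_comp (|Q ·|)
  have hright (b : V) : ∑ a, |Q (a - b)| = ∑ v, |Q v| := (Equiv.subRight b).sum_comp (|Q ·|)
  calc ∑ a, ∑ b, Q (a - b) * r a b
      ≤ ∑ a, ∑ b, (|Q (a - b)| * t a ^ 2 / 2 + |Q (a - b)| * t b ^ 2 / 2) := by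
        gcongr with a _ b _
        exact hterm a b
    _ = ∑ a, (∑ b, |Q (a - b)|) * t a ^ 2 / 2 + ∑ b, (∑ a, |Q (a - b)|) * t b ^ 2 / 2 := by
        simp only [Finset.sum_add_distrib, Finset.sum_mul, Finset.sum_div]
        rw [Finset.sum_comm (f := fun a b => |Q (a - b)| * t b ^ 2 / 2)]
    _ = (∑ v, |Q v|) * ∑ a, t a ^ 2 := by
        simp only [hleft, hright, ← Finset.sum_div, ← Finset.mul_sum]
        ring

open scoped Matrix.Norms.Frobenius

variable {E F : Type*} [Fintype E] [Fintype F]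

lemma frobenius_norm_sum_smul_sq {ι : Type*} [Fintype ι] (c : ι → ℝ) (Y : ι → Matrix E F ℂ) :
    ‖∑ a, c a • Y a‖ ^ 2 = ∑ a, ∑ b, c a * c b * ((Y a)ᴴ * Y b).trace.re := by
  simp only [frobenius_norm_sq, Matrix.conjTranspose_sum, Matrix.conjTranspose_smul, star_trivial,
    Matrix.sum_mul, Matrix.mul_sum, Matrix.smul_mul, Matrix.mul_smul, Matrix.trace_sum,
    Matrix.trace_smul, Complex.re_sum, Complex.real_smul, Complex.re_ofReal_mul, Finset.mul_sum]
  rw [Finset.sum_comm]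
  exact Finset.sum_congr rfl fun a _ => Finset.sum_congr rfl fun b _ => by ring

lemma sum_hashDev_norm_sq_le {p : 𝒢 → ℝ} (hp : p ∈ stdSimplex ℝ 𝒢)
    {g : 𝒢 → Bits n →ₗ[ZMod 2] Bits m} (hg : ∀ i, Function.Surjective (g i))
    (hu : IsUniversal₂ p (fun i => ⇑(g i))) (Y : Bits n → Matrix E F ℂ) :
    ∑ i, p i * ∑ k, ‖∑ a, hashDev (g i) k a • Y a‖ ^ 2 ≤ 2 * ∑ a, ‖Y a‖ ^ 2 := by
  have habs (a b : Bits n) : |((Y a)ᴴ * Y b).trace.re| ≤ ‖Y a‖ * ‖Y b‖ := by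
    rw [← Matrix.frobenius_norm_conjTranspose (Y a)]
    exact abs_re_trace_mul_le _ _
  calc ∑ i, p i * ∑ k, ‖∑ a, hashDev (g i) k a • Y a‖ ^ 2
      = ∑ a, ∑ b, (∑ i, p i * ∑ k, hashDev (g i) k a * hashDev (g i) k b) *
          ((Y a)ᴴ * Y b).trace.re := by
        simp only [frobenius_norm_sum_smul_sq, Finset.mul_sum, Finset.sum_mul, ← mul_assoc]
        rw [Finset.sum_comm_cycle]
        exact Finset.sum_congr rfl fun a _ => Finset.sum_comm_cycle
    _ = ∑ a, ∑ b, collisionDev p g (a - b) * ((Y a)ᴴ * Y b).trace.re := by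
        simp only [sum_mul_sum_hashDev_mul_hashDev hp]
    _ ≤ (∑ v, |collisionDev p g v|) * ∑ a, ‖Y a‖ ^ 2 := sum_sub_mul_le_of_abs_le _ habs
    _ ≤ 2 * ∑ a, ‖Y a‖ ^ 2 := by
        gcongr
        exact sum_abs_collisionDev_le hp hg hu

lemma sum_mul_sum_le_sqrt {κ : Type*} [Fintype κ] {p : 𝒢 → ℝ} (hp : p ∈ stdSimplex ℝ 𝒢)
    (x : 𝒢 → κ → ℝ) :
    ∑ i, p i * ∑ k, x i k ≤ √(Fintype.card κ * ∑ i, p i * ∑ k, x i k ^ 2) := by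
  refine Real.le_sqrt_of_sq_le ?_
  calc (∑ i, p i * ∑ k, x i k) ^ 2 ≤ ∑ i, p i * (∑ k, x i k) ^ 2 :=
        (Even.convexOn_pow even_two).map_sum_le (fun i _ => hp.1 i) hp.2 fun _ _ => Set.mem_univ _
    _ ≤ ∑ i, p i * (Fintype.card κ * ∑ k, x i k ^ 2) := by
        gcongr with i
        · exact hp.1 i
        · exact sq_sum_le_card_mul_sum_sq
    _ = Fintype.card κ * ∑ i, p i * ∑ k, x i k ^ 2 := by
        rw [Finset.mul_sum]
        exact Finset.sum_congr rfl fun i _ => mul_left_comm _ _ _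

end Universal

section HashAdvantage

open scoped Matrix.Norms.Frobenius

variable {n m : ℕ} {𝒢 : Type*} [Fintype 𝒢] {E κ : Type*} [Fintype E] [Fintype κ]

/-- The advantage with which the observables `V i k` distinguish the hash value `k = g i a` of the
classical register of `∑ a, |a⟩⟨a| ⊗ τ a` from a uniform `k`, when `i` is public and has
distribution `p`. The operators `τ a` may be arbitrary, so that the advantage is linear in `τ`. -/
def hashAdvantage (p : 𝒢 → ℝ) (g : 𝒢 → Bits n →ₗ[ZMod 2] Bits m) (V : 𝒢 → Bits m → Matrix E E ℂ)
    (τ : Bits n → Matrix E E ℂ) : ℝ :=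
  ∑ i, p i * ∑ k, (V i k * ∑ a, hashDev (g i) k a • τ a).trace.re

variable {p : 𝒢 → ℝ} {g : 𝒢 → Bits n →ₗ[ZMod 2] Bits m} {V : 𝒢 → Bits m → Matrix E E ℂ}

lemma hashAdvantage_add (τ τ' : Bits n → Matrix E E ℂ) :
    hashAdvantage p g V (fun a => τ a + τ' a) = hashAdvantage p g V τ + hashAdvantage p g V τ' := by
  simp only [hashAdvantage, smul_add, Finset.sum_add_distrib, Matrix.trace_add,
    Complex.add_re, mul_add]

lemma hashAdvantage_smul (c : ℝ) (τ : Bits n → Matrix E E ℂ) :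
    hashAdvantage p g V (fun a => c • τ a) = c * hashAdvantage p g V τ := by
  simp only [hashAdvantage, smul_comm _ c, ← Finset.smul_sum, Matrix.mul_smul, Matrix.trace_smul,
    Complex.smul_re, smul_eq_mul, ← Finset.mul_sum, mul_left_comm _ c]

lemma hashAdvantage_conjTranspose (τ : Bits n → Matrix E E ℂ) :
    hashAdvantage p g V (fun a => (τ a)ᴴ) = hashAdvantage p g (fun i k => (V i k)ᴴ) τ := by
  have hflip (i : 𝒢) (k : Bits m) : (V i k * ∑ a, hashDev (g i) k a • (τ a)ᴴ).trace.re =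
      ((V i k)ᴴ * ∑ a, hashDev (g i) k a • τ a).trace.re := by
    rw [← re_trace_conjTranspose, Matrix.conjTranspose_mul, Matrix.conjTranspose_sum,
      Matrix.trace_mul_comm]
    simp
  simp only [hashAdvantage, hflip]

lemma sum_abs_hashDev_le (g : Bits n →ₗ[ZMod 2] Bits m) (a : Bits n) :
    ∑ k, |hashDev g k a| ≤ 2 :=
  calc ∑ k, |hashDev g k a| ≤ ∑ k, ((if g a = k then 1 else 0) + (2 : ℝ) ^ (-(m : ℝ))) := by
        gcongr with k
        refine (abs_sub _ _).trans_eq ?_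
        rw [abs_of_nonneg (by split_ifs <;> norm_num), abs_of_nonneg (by positivity)]
    _ = 2 := by
        rw [Finset.sum_add_distrib, sum_bits_two_rpow_neg]
        norm_num

lemma hashAdvantage_le_of_posSemidef [DecidableEq E] (hp : p ∈ stdSimplex ℝ 𝒢)
    (hV : ∀ i k, IsContraction (V i k)) {τ : Bits n → Matrix E E ℂ} (hτ : ∀ a, (τ a).PosSemidef) :
    hashAdvantage p g V τ ≤ 2 * ∑ a, (τ a).trace.re := by
  have hterm (i : 𝒢) (k : Bits m) : (V i k * ∑ a, hashDev (g i) k a • τ a).trace.re ≤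
      ∑ a, |hashDev (g i) k a| * (τ a).trace.re := by
    simp only [Matrix.mul_sum, Matrix.mul_smul, Matrix.trace_sum, Matrix.trace_smul,
      Complex.re_sum, Complex.smul_re, smul_eq_mul]
    refine Finset.sum_le_sum fun a _ => (le_abs_self _).trans ?_
    rw [abs_mul]
    gcongr
    exact (hV i k).abs_re_trace_mul_le (hτ a)
  calc hashAdvantage p g V τ
      ≤ ∑ i, p i * ∑ k, ∑ a, |hashDev (g i) k a| * (τ a).trace.re := by
        unfold hashAdvantage
        gcongr with i _ k
        · exact hp.1 i
        · exact hterm i k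
    _ = ∑ i, p i * ∑ a, (∑ k, |hashDev (g i) k a|) * (τ a).trace.re := by
        simp only [Finset.sum_mul, Finset.sum_comm (γ := Bits n)]
    _ ≤ ∑ i, p i * ∑ a, 2 * (τ a).trace.re := by
        gcongr with i _ a
        · exact hp.1 i
        · exact re_trace_nonneg (hτ a)
        · exact sum_abs_hashDev_le (g i) a
    _ = 2 * ∑ a, (τ a).trace.re := by
        rw [← Finset.sum_mul, hp.2, one_mul, Finset.mul_sum]

lemma hashAdvantage_mul_le [DecidableEq E] (hp : p ∈ stdSimplex ℝ 𝒢)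
    (hg : ∀ i, Function.Surjective (g i)) (hu : IsUniversal₂ p (fun i => ⇑(g i)))
    (hV : ∀ i k, IsContraction (V i k)) (Y : Bits n → Matrix E κ ℂ) (S : Matrix κ E ℂ) :
    hashAdvantage p g V (fun a => Y a * S) ≤ √(2 ^ m * (2 * ∑ a, ‖Y a‖ ^ 2)) * ‖S‖ :=
  calc hashAdvantage p g V (fun a => Y a * S)
      ≤ ∑ i, p i * ∑ k, ‖∑ a, hashDev (g i) k a • Y a‖ * ‖S‖ := by
        unfold hashAdvantage
        gcongr with i _ k
        · exact hp.1 i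
        · simp only [← Matrix.smul_mul, ← Matrix.sum_mul]
          exact (hV i k).re_trace_mul_mul_le _ _
    _ = (∑ i, p i * ∑ k, ‖∑ a, hashDev (g i) k a • Y a‖) * ‖S‖ := by
        simp only [← Finset.sum_mul, ← mul_assoc]
    _ ≤ √(2 ^ m * (2 * ∑ a, ‖Y a‖ ^ 2)) * ‖S‖ := by
        gcongr
        refine (sum_mul_sum_le_sqrt hp _).trans (Real.sqrt_le_sqrt ?_)
        rw [card_bits, Nat.cast_pow, Nat.cast_ofNat]
        gcongr
        exact sum_hashDev_norm_sq_le hp hg hu Y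

lemma frobenius_norm_sqrt_sq [DecidableEq E] {A : Matrix E E ℂ} (hA : A.PosSemidef) :
    ‖CFC.sqrt A‖ ^ 2 = A.trace.re := by
  rw [frobenius_norm_sq, conjTranspose_sqrt_mul_sqrt hA]

lemma hashAdvantage_mul_conjTranspose_le [DecidableEq E] (hp : p ∈ stdSimplex ℝ 𝒢)
    (hg : ∀ i, Function.Surjective (g i)) (hu : IsUniversal₂ p (fun i => ⇑(g i)))
    (hV : ∀ i k, IsContraction (V i k)) {A : Matrix E E ℂ} (X : Bits n → Matrix E κ ℂ)
    {B : Bits n → Matrix E κ ℂ} (hB : ∀ a, B a * (B a)ᴴ ≤ A) :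
    hashAdvantage p g V (fun a => X a * (B a)ᴴ) ≤
      √(2 ^ m * (2 * ∑ a, ‖X a‖ ^ 2)) * √A.trace.re := by
  classical
  have hA : A.PosSemidef := Matrix.nonneg_iff_posSemidef.1 <|
    (Matrix.posSemidef_self_mul_conjTranspose (B 0)).nonneg.trans (hB 0)
  have hfactor (a : Bits n) : ∃ K : Matrix κ E ℂ, IsContraction K ∧ (B a)ᴴ = K * CFC.sqrt A :=
    exists_contraction_mul_of_conjTranspose_mul_self_le <| by
      simpa only [Matrix.conjTranspose_conjTranspose, conjTranspose_sqrt_mul_sqrt hA] using hB a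
  choose K hK hBK using hfactor
  simp only [hBK, ← Matrix.mul_assoc]
  refine (hashAdvantage_mul_le hp hg hu hV _ _).trans ?_
  rw [← frobenius_norm_sqrt_sq hA, Real.sqrt_sq (norm_nonneg _)]
  gcongr with a
  exact (hK a).norm_mul_le' (X a)

end HashAdvantage

section LeftoverHashing

open scoped Matrix.Norms.Frobenius

variable {X E κ : Type*}

/-- The rows of `N` whose first index is `a`. -/
def rowBlock (N : Matrix (X × E) κ ℂ) (a : X) : Matrix E κ ℂ := N.submatrix (Prod.mk a) id

/-- The diagonal block `⟨a|ρ|a⟩` of `ρ`. -/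
def diagBlock (ρ : Matrix (X × E) (X × E) ℂ) (a : X) : Matrix E E ℂ :=
  ρ.submatrix (Prod.mk a) (Prod.mk a)

lemma rowBlock_mul_conjTranspose [Fintype κ] (N B : Matrix (X × E) κ ℂ) (a : X) :
    rowBlock N a * (rowBlock B a)ᴴ = diagBlock (N * Bᴴ) a := rfl

lemma diagBlock_mono {ρ τ : Matrix (X × E) (X × E) ℂ} (h : ρ ≤ τ) (a : X) :
    diagBlock ρ a ≤ diagBlock τ a :=
  (Matrix.le_iff.1 h).submatrix (Prod.mk a)

lemma diagBlock_smul_one_kronecker [DecidableEq X] (c : ℝ) (σ : Matrix E E ℂ) (a : X) :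
    diagBlock (c • ((1 : Matrix X X ℂ) ⊗ₖ σ)) a = c • σ := by
  ext e e'
  simp [diagBlock]

lemma diagBlock_add_smul_mul_conjTranspose [Fintype κ] (N B : Matrix (X × E) κ ℂ) (F : ℝ) (a : X) :
    diagBlock ((N + F • B) * (N + F • B)ᴴ) a = rowBlock N a * (rowBlock N a)ᴴ +
      (F • (rowBlock (N + (F / 2) • B) a * (rowBlock B a)ᴴ) +
        F • (rowBlock (N + (F / 2) • B) a * (rowBlock B a)ᴴ)ᴴ) := by
  have hrow (c : ℝ) : rowBlock (N + c • B) a = rowBlock N a + c • rowBlock B a := rfl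
  rw [← rowBlock_mul_conjTranspose, hrow, hrow]
  simp only [Matrix.conjTranspose_add, Matrix.conjTranspose_mul, Matrix.conjTranspose_smul,
    Matrix.conjTranspose_conjTranspose, Matrix.add_mul, Matrix.mul_add, Matrix.smul_mul,
    Matrix.mul_smul, star_trivial]
  module

variable [Fintype E] [Fintype κ]

lemma sum_frobenius_norm_rowBlock_sq [Fintype X] (N : Matrix (X × E) κ ℂ) :
    ∑ a, ‖rowBlock N a‖ ^ 2 = ‖N‖ ^ 2 := by
  simp only [frobenius_norm_sq', rowBlock_mul_conjTranspose, ← Complex.re_sum]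
  simp [Matrix.trace, diagBlock, Fintype.sum_prod_type]

variable {n m : ℕ} {𝒢 : Type*} [Fintype 𝒢]

lemma hashAdvantage_add_smul_le [DecidableEq E] {p : 𝒢 → ℝ} (hp : p ∈ stdSimplex ℝ 𝒢)
    {g : 𝒢 → Bits n →ₗ[ZMod 2] Bits m} (hg : ∀ i, Function.Surjective (g i))
    (hu : IsUniversal₂ p (fun i => ⇑(g i))) {V : 𝒢 → Bits m → Matrix E E ℂ}
    (hV : ∀ i k, IsContraction (V i k)) {A : Matrix E E ℂ} {N B : Matrix (Bits n × E) κ ℂ}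
    (hBA : ∀ a, diagBlock (B * Bᴴ) a ≤ A) (hB : ‖B‖ ≤ 1) {F : ℝ} (hF : 0 ≤ F)
    (hN : F ^ 2 + ‖N‖ ^ 2 ≤ 1) :
    hashAdvantage p g V (diagBlock ((N + F • B) * (N + F • B)ᴴ)) ≤
      2 * ‖N‖ ^ 2 + 2 * √2 * (√(2 ^ m) * √A.trace.re) := by
  set X := N + (F / 2) • B
  have hmain : hashAdvantage p g V (fun a => rowBlock N a * (rowBlock N a)ᴴ) ≤ 2 * ‖N‖ ^ 2 := by
    refine (hashAdvantage_le_of_posSemidef hp hV fun a =>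
      Matrix.posSemidef_self_mul_conjTranspose _).trans_eq ?_
    simp only [← frobenius_norm_sq', sum_frobenius_norm_rowBlock_sq]
  have hXnorm : ‖X‖ ≤ ‖N‖ + F / 2 :=
    calc ‖X‖ ≤ ‖N‖ + F / 2 * ‖B‖ := by
          refine (norm_add_le _ _).trans_eq ?_
          rw [norm_smul, Real.norm_of_nonneg (by positivity)]
      _ ≤ ‖N‖ + F / 2 * 1 := by gcongr
      _ = ‖N‖ + F / 2 := by rw [mul_one]
  set c := √2 * (√(2 ^ m) * √A.trace.re)
  have hcross {V : 𝒢 → Bits m → Matrix E E ℂ} (hV : ∀ i k, IsContraction (V i k)) :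
      hashAdvantage p g V (fun a => rowBlock X a * (rowBlock B a)ᴴ) ≤ (‖N‖ + F / 2) * c := by
    refine (hashAdvantage_mul_conjTranspose_le hp hg hu hV _ hBA).trans ?_
    rw [sum_frobenius_norm_rowBlock_sq, Real.sqrt_mul (by positivity),
      Real.sqrt_mul zero_le_two, Real.sqrt_sq (norm_nonneg _)]
    calc √(2 ^ m) * (√2 * ‖X‖) * √A.trace.re = ‖X‖ * c := by ring
      _ ≤ (‖N‖ + F / 2) * c := by gcongr
  have hweight : 2 * F * (‖N‖ + F / 2) ≤ 2 := by nlinarith [sq_nonneg (F - ‖N‖)]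
  calc hashAdvantage p g V (diagBlock ((N + F • B) * (N + F • B)ᴴ))
      = hashAdvantage p g V (fun a => rowBlock N a * (rowBlock N a)ᴴ) +
        (F * hashAdvantage p g V (fun a => rowBlock X a * (rowBlock B a)ᴴ) +
        F * hashAdvantage p g (fun i k => (V i k)ᴴ) fun a => rowBlock X a * (rowBlock B a)ᴴ) := by
        rw [← hashAdvantage_conjTranspose, ← hashAdvantage_smul, ← hashAdvantage_smul,
          ← hashAdvantage_add, ← hashAdvantage_add]
        exact congrArg _ (funext fun a => diagBlock_add_smul_mul_conjTranspose N B F a)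
    _ ≤ 2 * ‖N‖ ^ 2 + (F * ((‖N‖ + F / 2) * c) + F * ((‖N‖ + F / 2) * c)) := by
        gcongr
        · exact hcross hV
        · exact hcross fun i k => (hV i k).conjTranspose
    _ = 2 * ‖N‖ ^ 2 + 2 * F * (‖N‖ + F / 2) * c := by ring
    _ ≤ 2 * ‖N‖ ^ 2 + 2 * c := by gcongr
    _ = 2 * ‖N‖ ^ 2 + 2 * √2 * (√(2 ^ m) * √A.trace.re) := by ring

end LeftoverHashing

section Smoothing

open scoped Matrix.Norms.Frobenius

variable {α : Type*} [Fintype α] [DecidableEq α]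

lemma traceNorm_nonneg (M : Matrix α α ℂ) : 0 ≤ traceNorm M :=
  re_trace_nonneg (Matrix.nonneg_iff_posSemidef.1 (CFC.sqrt_nonneg _))

lemma fidelity_nonneg (ρ τ : Matrix α α ℂ) : 0 ≤ fidelity ρ τ :=
  add_nonneg (traceNorm_nonneg _) (Real.sqrt_nonneg _)

/-- A form of Uhlmann's theorem. -/
lemma exists_contraction_norm_sqrt_sub_fidelity_smul_le {ρ τ : Matrix α α ℂ}
    (hρ : IsSubnormalized ρ) (hτ : IsSubnormalized τ) :
    ∃ W : Matrix α α ℂ, IsContraction W ∧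
      ‖CFC.sqrt ρ - fidelity τ ρ • (CFC.sqrt τ * W)‖ ^ 2 ≤ 1 - fidelity τ ρ ^ 2 := by
  obtain ⟨U, hU, hUtrace⟩ :=
    exists_contraction_re_trace_mul_eq_traceNorm (CFC.sqrt τ * CFC.sqrt ρ)
  refine ⟨Uᴴ, hU.conjTranspose, ?_⟩
  set F := fidelity τ ρ with hF
  set x := √(1 - τ.trace.re)
  set y := √(1 - ρ.trace.re)
  have hx : x ^ 2 = 1 - τ.trace.re := Real.sq_sqrt (by linarith [hτ.2])
  have hy : y ^ 2 = 1 - ρ.trace.re := Real.sq_sqrt (by linarith [hρ.2])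
  have hoverlap : ((CFC.sqrt ρ)ᴴ * (CFC.sqrt τ * Uᴴ)).trace.re = F - x * y := by
    rw [← re_trace_conjTranspose, Matrix.conjTranspose_mul, Matrix.conjTranspose_mul,
      Matrix.conjTranspose_conjTranspose, Matrix.conjTranspose_conjTranspose,
      (isHermitian_sqrt τ).eq, Matrix.mul_assoc, hUtrace, hF, fidelity,
      Real.sqrt_mul (by linarith [hτ.2])]
    ring
  have hB : ‖CFC.sqrt τ * Uᴴ‖ ^ 2 ≤ τ.trace.re := by
    rw [← frobenius_norm_sqrt_sq hτ.1]
    gcongr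
    exact hU.conjTranspose.norm_mul_le' _
  rw [frobenius_norm_sub_smul_sq, hoverlap, frobenius_norm_sqrt_sq hρ.1]
  calc ρ.trace.re - 2 * F * (F - x * y) + F ^ 2 * ‖CFC.sqrt τ * Uᴴ‖ ^ 2
      ≤ ρ.trace.re - 2 * F * (F - x * y) + F ^ 2 * τ.trace.re := by gcongr
    _ = 1 - F ^ 2 - (y - F * x) ^ 2 := by linear_combination hy + F ^ 2 * hx
    _ ≤ 1 - F ^ 2 := sub_le_self _ (sq_nonneg _)

lemma exists_contraction_eq_sqrt_mul_mul_conjTranspose {ρ τ : Matrix α α ℂ} (hτ : τ.PosSemidef)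
    (h : τ ≤ ρ) : ∃ Q : Matrix α α ℂ, IsContraction Q ∧
      τ = CFC.sqrt ρ * Q * (CFC.sqrt ρ * Q)ᴴ := by
  have hρ : ρ.PosSemidef := Matrix.nonneg_iff_posSemidef.1 (hτ.nonneg.trans h)
  obtain ⟨K, hK, hKρ⟩ := exists_contraction_mul_of_conjTranspose_mul_self_le
    (A := CFC.sqrt τ) (B := CFC.sqrt ρ) <| by
      rwa [conjTranspose_sqrt_mul_sqrt hτ, conjTranspose_sqrt_mul_sqrt hρ]
  refine ⟨Kᴴ, hK.conjTranspose, ?_⟩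
  rw [Matrix.conjTranspose_mul, Matrix.conjTranspose_conjTranspose, (isHermitian_sqrt ρ).eq, ← hKρ,
    ← (isHermitian_sqrt ρ).eq, ← Matrix.conjTranspose_mul, ← hKρ, conjTranspose_sqrt_mul_sqrt hτ]

lemma IsContraction.sqrt_mul_mul_conjTranspose_le {W ρ : Matrix α α ℂ} (hW : IsContraction W)
    (hρ : ρ.PosSemidef) : CFC.sqrt ρ * W * (CFC.sqrt ρ * W)ᴴ ≤ ρ :=
  calc CFC.sqrt ρ * W * (CFC.sqrt ρ * W)ᴴ = (CFC.sqrt ρ)ᴴ * (Wᴴᴴ * Wᴴ) * CFC.sqrt ρ := by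
        rw [Matrix.conjTranspose_mul, Matrix.conjTranspose_conjTranspose, (isHermitian_sqrt ρ).eq]
        simp only [Matrix.mul_assoc]
    _ ≤ (CFC.sqrt ρ)ᴴ * 1 * CFC.sqrt ρ := conjTranspose_mul_mul_mono hW.conjTranspose _
    _ = ρ := by rw [Matrix.mul_one, conjTranspose_sqrt_mul_sqrt hρ]

lemma two_mul_sqrt_two_mul_sqrt_rpow (m : ℕ) (H : ℝ) :
    2 * √2 * (√(2 ^ m) * √((2 : ℝ) ^ (-H))) = (2 : ℝ) ^ (((m : ℝ) - H + 3) / 2) := by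
  have h2 : (0 : ℝ) < 2 := two_pos
  rw [Real.sqrt_eq_rpow, ← Real.rpow_natCast 2 m, Real.sqrt_eq_rpow, Real.sqrt_eq_rpow,
    ← Real.rpow_mul h2.le, ← Real.rpow_mul h2.le]
  nth_rw 1 [← Real.rpow_one 2]
  rw [← Real.rpow_add h2, ← Real.rpow_add h2, ← Real.rpow_add h2]
  congr 1
  ring

variable {n m : ℕ} {𝒢 : Type*} [Fintype 𝒢] {E : Type*} [Fintype E] [DecidableEq E]

lemma hashAdvantage_diagBlock_le {p : 𝒢 → ℝ} (hp : p ∈ stdSimplex ℝ 𝒢)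
    {g : 𝒢 → Bits n →ₗ[ZMod 2] Bits m} (hg : ∀ i, Function.Surjective (g i))
    (hu : IsUniversal₂ p (fun i => ⇑(g i))) {V : 𝒢 → Bits m → Matrix E E ℂ}
    (hV : ∀ i k, IsContraction (V i k)) {ρ ρ' τ : Matrix (Bits n × E) (Bits n × E) ℂ}
    (hρ : IsSubnormalized ρ) (hρ' : IsSubnormalized ρ') (hτ : τ.PosSemidef) (hτρ : τ ≤ ρ)
    {ε r : ℝ} (hP : purifiedDistance ρ' ρ ≤ ε) {σ : Matrix E E ℂ} (hσ : σ.trace = 1)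
    (hr : ρ' ≤ ((2 : ℝ) ^ (-r)) • ((1 : Matrix (Bits n) (Bits n) ℂ) ⊗ₖ σ)) :
    hashAdvantage p g V (diagBlock τ) ≤ 2 * ε + (2 : ℝ) ^ (((m : ℝ) - r + 3) / 2) := by
  obtain ⟨W, hW, hWF⟩ := exists_contraction_norm_sqrt_sub_fidelity_smul_le hρ hρ'
  obtain ⟨Q, hQ, hτQ⟩ := exists_contraction_eq_sqrt_mul_mul_conjTranspose hτ hτρ
  set F := fidelity ρ' ρ
  set N₀ := CFC.sqrt ρ - F • (CFC.sqrt ρ' * W) with hN₀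
  set N := N₀ * Q
  set B := CFC.sqrt ρ' * (W * Q)
  have hNN₀ : ‖N‖ ≤ ‖N₀‖ := hQ.norm_mul_le' _
  have hNF : F ^ 2 + ‖N‖ ^ 2 ≤ 1 := by linarith [pow_le_pow_left₀ (norm_nonneg N) hNN₀ 2]
  have hN_one : ‖N‖ ≤ 1 :=
    (sq_le_one_iff₀ (norm_nonneg N)).1 (by linarith [sq_nonneg F])
  have hN_ε : ‖N‖ ≤ ε := (hNN₀.trans (Real.le_sqrt_of_sq_le hWF)).trans hP
  have hB : ‖B‖ ≤ 1 := by
    rw [← sq_le_one_iff₀ (norm_nonneg B)]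
    refine le_trans ?_ ((frobenius_norm_sqrt_sq hρ'.1).trans_le hρ'.2)
    gcongr
    exact (hW.mul hQ).norm_mul_le' _
  have hBσ (a : Bits n) : diagBlock (B * Bᴴ) a ≤ ((2 : ℝ) ^ (-r)) • σ := by
    rw [← diagBlock_smul_one_kronecker _ σ a]
    exact diagBlock_mono (((hW.mul hQ).sqrt_mul_mul_conjTranspose_le hρ'.1).trans hr) a
  have hR : CFC.sqrt ρ * Q = N + F • B := by
    simp only [N, B, hN₀, Matrix.sub_mul, Matrix.smul_mul, Matrix.mul_assoc, sub_add_cancel]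
  have htrace : (((2 : ℝ) ^ (-r)) • σ).trace.re = (2 : ℝ) ^ (-r) := by
    simp [Matrix.trace_smul, hσ]
  calc hashAdvantage p g V (diagBlock τ)
      ≤ 2 * ‖N‖ ^ 2 + 2 * √2 * (√(2 ^ m) * √((2 : ℝ) ^ (-r))) := by
        rw [hτQ, hR, ← htrace]
        exact hashAdvantage_add_smul_le hp hg hu hV hBσ hB (fidelity_nonneg _ _) hNF
    _ ≤ 2 * ε + (2 : ℝ) ^ (((m : ℝ) - r + 3) / 2) := by
        rw [two_mul_sqrt_two_mul_sqrt_rpow]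
        gcongr
        exact (pow_le_of_le_one (norm_nonneg N) hN_one two_ne_zero).trans hN_ε

theorem hashAdvantage_diagBlock_le_smoothMinEntropy {p : 𝒢 → ℝ} (hp : p ∈ stdSimplex ℝ 𝒢)
    {g : 𝒢 → Bits n →ₗ[ZMod 2] Bits m} (hg : ∀ i, Function.Surjective (g i))
    (hu : IsUniversal₂ p (fun i => ⇑(g i))) {V : 𝒢 → Bits m → Matrix E E ℂ}
    (hV : ∀ i k, IsContraction (V i k)) {ρ τ : Matrix (Bits n × E) (Bits n × E) ℂ}
    (hρ : IsSubnormalized ρ) (hτ : τ.PosSemidef) (hτρ : τ ≤ ρ)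
    {ε Hth : ℝ} (hSM : (Hth : EReal) ≤ smoothMinEntropy ε ρ) :
    hashAdvantage p g V (diagBlock τ) ≤ 2 * ε + (2 : ℝ) ^ (((m : ℝ) - Hth + 3) / 2) := by
  have hlt : ∀ H < Hth,
      hashAdvantage p g V (diagBlock τ) ≤ 2 * ε + (2 : ℝ) ^ (((m : ℝ) - H + 3) / 2) := by
    intro H hH
    obtain ⟨_, ⟨ρ', hρ', hP, rfl⟩, hHρ'⟩ :=
      lt_sSup_iff.1 ((EReal.coe_lt_coe_iff.2 hH).trans_le hSM)
    obtain ⟨_, ⟨r, rfl, σ, -, hσ, hr⟩, hHr⟩ := lt_sSup_iff.1 hHρ'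
    refine (hashAdvantage_diagBlock_le hp hg hu hV hρ hρ' hτ hτρ hP hσ hr).trans ?_
    have := EReal.coe_lt_coe_iff.1 hHr
    gcongr
    exact one_le_two
  have hcont : Continuous fun H : ℝ => 2 * ε + (2 : ℝ) ^ (((m : ℝ) - H + 3) / 2) := by
    fun_prop (disch := norm_num)
  exact ge_of_tendsto (hcont.continuousWithinAt (s := Set.Iio Hth) (x := Hth))
    (Filter.eventually_of_mem self_mem_nhdsWithin hlt)

end Smoothing

section Kronecker

variable {ι α β γ δ : Type*}

lemma sum_kronecker (s : Finset ι) (A : ι → Matrix α β ℂ) (B : Matrix γ δ ℂ) :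
    (∑ i ∈ s, A i) ⊗ₖ B = ∑ i ∈ s, A i ⊗ₖ B := by
  ext
  simp only [Matrix.sum_apply, Matrix.kroneckerMap_apply, Finset.sum_mul]

lemma kronecker_sum (s : Finset ι) (A : Matrix α β ℂ) (B : ι → Matrix γ δ ℂ) :
    A ⊗ₖ (∑ i ∈ s, B i) = ∑ i ∈ s, A ⊗ₖ B i := by
  ext
  simp only [Matrix.sum_apply, Matrix.kroneckerMap_apply, Finset.mul_sum]

lemma proj_apply [DecidableEq α] (i x y : α) :
    proj i x y = (if i = x then 1 else 0) * (if i = y then 1 else 0) := by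
  rw [proj, Matrix.single_apply, ite_zero_mul_ite_zero, mul_one]

lemma posSemidef_proj [DecidableEq α] (i : α) : (proj i).PosSemidef := by
  classical
  rw [proj, ← Matrix.diagonal_single]
  refine Matrix.PosSemidef.diagonal fun x => ?_
  rw [Pi.zero_apply, Pi.single_apply]
  split_ifs <;> simp

lemma trace_proj [Fintype α] [DecidableEq α] (i : α) : (proj i).trace = 1 :=
  Matrix.trace_single_eq_same i 1

lemma proj_kronecker_proj [DecidableEq α] [DecidableEq β] (a : α) (b : β) :
    proj a ⊗ₖ proj b = proj (a, b) := by
  rw [proj, proj, proj, Matrix.single_kronecker_single, mul_one]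

lemma sum_smul_proj [Fintype α] [DecidableEq α] (w : α → ℝ) :
    ∑ i, w i • proj i = Matrix.diagonal fun i => (w i : ℂ) := by
  ext x y
  rcases eq_or_ne x y with rfl | h
  · simp [Matrix.sum_apply, proj_apply]
  · simp [Matrix.sum_apply, proj_apply, h, h.symm]

lemma trace_mul_proj_kronecker [Fintype α] [DecidableEq α] [Fintype β]
    (V : Matrix (α × β) (α × β) ℂ) (i : α) (A : Matrix β β ℂ) :
    (V * (proj i ⊗ₖ A)).trace = (V.submatrix (Prod.mk i) (Prod.mk i) * A).trace := by
  simp [Matrix.trace, Matrix.mul_apply, Fintype.sum_prod_type, proj_apply]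

lemma trace_mul_kronecker_proj [Fintype α] [Fintype β] [DecidableEq β]
    (V : Matrix (α × β) (α × β) ℂ) (A : Matrix α α ℂ) (i : β) :
    (V * (A ⊗ₖ proj i)).trace = (V.submatrix (·, i) (·, i) * A).trace := by
  simp [Matrix.trace, Matrix.mul_apply, Fintype.sum_prod_type, proj_apply]

lemma re_trace_mul_kronecker_diagonal [Fintype α] [Fintype β] [DecidableEq β]
    (V : Matrix (α × β) (α × β) ℂ) (A : Matrix α α ℂ) (w : β → ℝ) :
    (V * (A ⊗ₖ Matrix.diagonal fun z => (w z : ℂ))).trace.re =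
      ∑ z, w z * (V.submatrix (·, z) (·, z) * A).trace.re := by
  simp only [← sum_smul_proj, kronecker_sum, Matrix.kronecker_smul, Matrix.mul_sum,
    Matrix.mul_smul, Matrix.trace_sum, Matrix.trace_smul, trace_mul_kronecker_proj,
    Complex.re_sum, Complex.smul_re, smul_eq_mul]

end Kronecker

section PartialTrace

variable {α β γ : Type*}

lemma posSemidef_trFst [Fintype α] {ρ : Matrix (α × β) (α × β) ℂ} (hρ : ρ.PosSemidef) :
    (trFst ρ).PosSemidef := by
  have hsum : trFst ρ = ∑ x, ρ.submatrix (Prod.mk x) (Prod.mk x) := by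
    ext
    simp only [trFst, Matrix.sum_apply, Matrix.submatrix_apply]
  rw [hsum]
  exact Matrix.posSemidef_sum _ fun x _ => hρ.submatrix _

lemma trace_trFst [Fintype α] [Fintype β] (ρ : Matrix (α × β) (α × β) ℂ) :
    (trFst ρ).trace = ρ.trace := by
  simp only [Matrix.trace, trFst, Matrix.diag_apply, Fintype.sum_prod_type]
  exact Finset.sum_comm

lemma trace_trSnd [Fintype α] [Fintype β] (ρ : Matrix (α × β) (α × β) ℂ) :
    (trSnd ρ).trace = ρ.trace := by
  rw [Matrix.trace, Matrix.trace, Fintype.sum_prod_type]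
  rfl

lemma trFst_sum [Fintype α] {ι : Type*} (s : Finset ι) (ρ : ι → Matrix (α × β) (α × β) ℂ) :
    trFst (∑ i ∈ s, ρ i) = ∑ i ∈ s, trFst (ρ i) := by
  ext
  simp only [trFst, Matrix.sum_apply]
  exact Finset.sum_comm

lemma trace_mul_mul_conjTranspose [Fintype α] [Fintype γ] (K : Matrix γ α ℂ) (ρ : Matrix α α ℂ) :
    (K * ρ * Kᴴ).trace = (Kᴴ * K * ρ).trace := by
  rw [Matrix.trace_mul_comm, ← Matrix.mul_assoc]

lemma re_trace_sum_mul_mul_conjTranspose_le {ι : Type*} [Fintype α] [DecidableEq α] [Fintype γ]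
    {s : Finset ι} {K : ι → Matrix γ α ℂ} (hK : ∑ i ∈ s, (K i)ᴴ * K i ≤ 1) {ρ : Matrix α α ℂ}
    (hρ : ρ.PosSemidef) : (∑ i ∈ s, K i * ρ * (K i)ᴴ).trace.re ≤ ρ.trace.re := by
  set L := CFC.sqrt ρ
  have hL : Lᴴ * L = ρ := conjTranspose_sqrt_mul_sqrt hρ
  have hL' : L * Lᴴ = ρ := by
    rw [(isHermitian_sqrt ρ : Lᴴ = L)] at hL ⊢
    exact hL
  calc (∑ i ∈ s, K i * ρ * (K i)ᴴ).trace.re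
      = (Lᴴ * (∑ i ∈ s, (K i)ᴴ * K i) * L).trace.re := by
        rw [Matrix.trace_mul_comm, ← Matrix.mul_assoc, hL', Matrix.mul_sum]
        simp only [Matrix.trace_sum, trace_mul_mul_conjTranspose, Matrix.trace_mul_comm ρ]
    _ ≤ (Lᴴ * 1 * L).trace.re := re_trace_mono (conjTranspose_mul_mul_mono hK L)
    _ = ρ.trace.re := by rw [Matrix.mul_one, hL]

lemma trFst_smul [Fintype α] (c : ℝ) (ρ : Matrix (α × β) (α × β) ℂ) :
    trFst (c • ρ) = c • trFst ρ := by
  ext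
  simp only [trFst, Matrix.smul_apply, Finset.smul_sum]

lemma trSnd_sum [Fintype β] {ι : Type*} (s : Finset ι) (ρ : ι → Matrix (α × β) (α × β) ℂ) :
    trSnd (∑ i ∈ s, ρ i) = ∑ i ∈ s, trSnd (ρ i) := by
  ext
  simp only [trSnd, Matrix.sum_apply]
  exact Finset.sum_comm

lemma trSnd_smul [Fintype β] (c : ℝ) (ρ : Matrix (α × β) (α × β) ℂ) :
    trSnd (c • ρ) = c • trSnd ρ := by
  ext
  simp only [trSnd, Matrix.smul_apply, Finset.smul_sum]

lemma trFst_kronecker [Fintype α] (A : Matrix α α ℂ) (B : Matrix β β ℂ) :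
    trFst (A ⊗ₖ B) = A.trace • B := by
  ext
  simp only [trFst, Matrix.kroneckerMap_apply, ← Finset.sum_mul]
  rfl

lemma trSnd_kronecker [Fintype β] (A : Matrix α α ℂ) (B : Matrix β β ℂ) :
    trSnd (A ⊗ₖ B) = B.trace • A := by
  ext
  simp only [trSnd, Matrix.kroneckerMap_apply, ← Finset.mul_sum, Matrix.smul_apply, smul_eq_mul,
    mul_comm B.trace]
  rfl

lemma trace_one_kronecker_mul [Fintype α] [DecidableEq α] [Fintype β]
    (X : Matrix β β ℂ) (ρ : Matrix (α × β) (α × β) ℂ) :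
    (((1 : Matrix α α ℂ) ⊗ₖ X) * ρ).trace = (X * trFst ρ).trace := by
  simp only [Matrix.trace, Matrix.diag_apply, Matrix.mul_apply, Matrix.kroneckerMap_apply, trFst,
    Fintype.sum_prod_type, Finset.mul_sum, Matrix.one_apply, ite_mul, one_mul, zero_mul,
    Finset.sum_ite_irrel, Finset.sum_const_zero, Finset.sum_ite_eq, Finset.mem_univ, if_true]
  symm
  exact Finset.sum_comm_cycle

lemma trace_kronecker_one_mul [Fintype α] [Fintype β] [DecidableEq β] (X : Matrix α α ℂ)
    (ρ : Matrix (α × β) (α × β) ℂ) :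
    ((X ⊗ₖ (1 : Matrix β β ℂ)) * ρ).trace = (X * trSnd ρ).trace := by
  simp only [Matrix.trace, Matrix.diag_apply, Matrix.mul_apply, Matrix.kroneckerMap_apply, trSnd,
    Fintype.sum_prod_type, Finset.mul_sum, Matrix.one_apply, mul_ite, mul_one, mul_zero, ite_mul,
    zero_mul, Finset.sum_ite_eq, Finset.mem_univ, if_true]
  exact Finset.sum_congr rfl fun a _ => Finset.sum_comm

end PartialTrace

section HashAdvantage

variable {n m : ℕ} {E Z 𝒢 : Type*} [Fintype E] [Fintype 𝒢] {p : 𝒢 → ℝ}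
  {g : 𝒢 → Bits n →ₗ[ZMod 2] Bits m}

lemma hashAdvantage_eq_sum_sub (V : 𝒢 → Bits m → Matrix E E ℂ) (τ : Bits n → Matrix E E ℂ) :
    hashAdvantage p g V τ = ∑ i, p i * ∑ a, ((V i (g i a) * τ a).trace.re -
      ∑ k, (2 : ℝ) ^ (-(m : ℝ)) * (V i k * τ a).trace.re) := by
  simp only [hashAdvantage, hashDev, Matrix.mul_sum, Matrix.mul_smul, Matrix.trace_sum,
    Matrix.trace_smul, Complex.re_sum, Complex.smul_re, smul_eq_mul, sub_mul, ite_mul, one_mul,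
    zero_mul, Finset.sum_sub_distrib]
  refine Finset.sum_congr rfl fun i _ => ?_
  congr 2
  · rw [Finset.sum_comm]
    simp
  · exact Finset.sum_comm

lemma hashAdvantage_kronecker_diagonal_le [DecidableEq E] [Fintype Z] [DecidableEq Z]
    {w : Z → ℝ} (hw : w ∈ stdSimplex ℝ Z) {τ : Bits n → Matrix E E ℂ} {C : ℝ}
    (h : ∀ V : 𝒢 → Bits m → Matrix E E ℂ, (∀ i k, IsContraction (V i k)) →
      hashAdvantage p g V τ ≤ C)
    {V : 𝒢 → Bits m → Matrix (E × Z) (E × Z) ℂ} (hV : ∀ i k, IsContraction (V i k)) :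
    hashAdvantage p g V (fun a => τ a ⊗ₖ Matrix.diagonal fun z => (w z : ℂ)) ≤ C :=
  calc hashAdvantage p g V (fun a => τ a ⊗ₖ Matrix.diagonal fun z => (w z : ℂ))
      = ∑ z, w z * hashAdvantage p g (fun i k => (V i k).submatrix (·, z) (·, z)) τ := by
        simp only [hashAdvantage, ← Matrix.smul_kronecker, ← sum_kronecker,
          re_trace_mul_kronecker_diagonal, Finset.mul_sum]
        rw [Finset.sum_comm_cycle]
        simp only [mul_left_comm]
    _ ≤ ∑ z, w z * C := by
        gcongr with z
        exacts [hw.1 z, h _ fun i k => (hV i k).submatrix fun _ _ => by simp]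
    _ = C := by rw [← Finset.sum_mul, hw.2, one_mul]

end HashAdvantage

section KeyStates

variable {K E 𝒢 : Type*} [Fintype K] [DecidableEq K] [Fintype 𝒢] [DecidableEq 𝒢]

/-- The state `∑_i p_i ∑_k |k⟩⟨k| ⊗ X_{i,k} ⊗ |i⟩⟨i|` of a key, Eve's system and the public index
of a random hash function. -/
def keyState (p : 𝒢 → ℝ) (X : 𝒢 → K → Matrix E E ℂ) : Matrix (K × E × 𝒢) (K × E × 𝒢) ℂ :=
  ∑ i, ∑ k, p i • (proj k ⊗ₖ (X i k ⊗ₖ proj i))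

/-- The block of `U` at the value `k` of the key and at the index `i` of the hash function. -/
def keyBlock (U : Matrix (K × E × 𝒢) (K × E × 𝒢) ℂ) (i : 𝒢) (k : K) : Matrix E E ℂ :=
  U.submatrix (fun e => (k, e, i)) (fun e => (k, e, i))

lemma trace_mul_proj_kronecker_kronecker_proj [Fintype E]
    (U : Matrix (K × E × 𝒢) (K × E × 𝒢) ℂ) (k : K) (X : Matrix E E ℂ) (i : 𝒢) :
    (U * (proj k ⊗ₖ (X ⊗ₖ proj i))).trace = (keyBlock U i k * X).trace := by
  rw [trace_mul_proj_kronecker, trace_mul_kronecker_proj]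
  rfl

lemma traceNorm_keyState_le [Fintype E] [DecidableEq E] {p : 𝒢 → ℝ}
    {X : 𝒢 → K → Matrix E E ℂ} {C : ℝ}
    (h : ∀ V : 𝒢 → K → Matrix E E ℂ, (∀ i k, IsContraction (V i k)) →
      ∑ i, p i * ∑ k, (V i k * X i k).trace.re ≤ C) :
    traceNorm (keyState p X) ≤ C := by
  refine traceNorm_le fun U hU => ?_
  convert h (keyBlock U) fun i k => hU.submatrix fun _ _ => by simp
  simp only [keyState, Matrix.mul_smul, Matrix.trace_sum, Matrix.trace_smul,
    trace_mul_proj_kronecker_kronecker_proj, Complex.re_sum, Complex.smul_re, smul_eq_mul,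
    Finset.mul_sum]

lemma sum_proj_kronecker_hashState (p : 𝒢 → ℝ) (c : ℝ) (ρ : Matrix E E ℂ) :
    ∑ k : K, c • (proj k ⊗ₖ (ρ ⊗ₖ hashState p)) = keyState p fun _ _ => c • ρ := by
  simp only [keyState, hashState, kronecker_sum, Matrix.kronecker_smul, Matrix.smul_kronecker,
    Finset.smul_sum, smul_comm c]
  exact Finset.sum_comm

lemma keyState_sub (p : 𝒢 → ℝ) (X Y : 𝒢 → K → Matrix E E ℂ) :
    keyState p X - keyState p Y = keyState p fun i k => X i k - Y i k := by
  rw [sub_eq_iff_eq_add]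
  simp only [keyState, ← Finset.sum_add_distrib, ← smul_add, ← Matrix.kronecker_add,
    ← Matrix.add_kronecker, sub_add_cancel]

lemma trSnd_trFst_keyState {p : 𝒢 → ℝ} (hp : p ∈ stdSimplex ℝ 𝒢) {X : 𝒢 → K → Matrix E E ℂ}
    {ρ : Matrix E E ℂ} (hX : ∀ i, ∑ k, X i k = ρ) : trSnd (trFst (keyState p X)) = ρ := by
  simp only [keyState, trFst_sum, trFst_smul, trFst_kronecker, trSnd_sum, trSnd_smul,
    trSnd_kronecker, trace_proj, one_smul, ← Finset.smul_sum, hX, ← Finset.sum_smul, hp.2]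

lemma d₁_keyState_le {m : ℕ} [Fintype E] [DecidableEq E] {p : 𝒢 → ℝ} (hp : p ∈ stdSimplex ℝ 𝒢)
    {X : 𝒢 → Bits m → Matrix E E ℂ} {ρ : Matrix E E ℂ} (hX : ∀ i, ∑ k, X i k = ρ) {C : ℝ}
    (h : ∀ V : 𝒢 → Bits m → Matrix E E ℂ, (∀ i k, IsContraction (V i k)) →
      ∑ i, p i * ∑ k, (V i k * (X i k - (2 : ℝ) ^ (-(m : ℝ)) • ρ)).trace.re ≤ C) :
    d₁ p (keyState p X) ≤ C := by
  rw [d₁, trSnd_trFst_keyState hp hX, sum_proj_kronecker_hashState, keyState_sub]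
  exact traceNorm_keyState_le h

variable {n m : ℕ}

lemma sum_sum_fiber {M : Type*} [AddCommMonoid M] (g : Bits n → Bits m) (τ : Bits n → M) :
    ∑ k, ∑ a with g a = k, τ a = ∑ a, τ a :=
  Finset.sum_fiberwise _ _ _

lemma sum_fiber_sub_smul_sum (g : Bits n →ₗ[ZMod 2] Bits m) (τ : Bits n → Matrix E E ℂ)
    (k : Bits m) : ∑ a with g a = k, τ a - (2 : ℝ) ^ (-(m : ℝ)) • ∑ a, τ a =
      ∑ a, hashDev g k a • τ a := by
  simp only [hashDev, sub_smul, Finset.sum_sub_distrib, Finset.smul_sum, Finset.sum_filter,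
    ite_smul, one_smul, zero_smul]

lemma d₁_keyState_hash_le [Fintype E] [DecidableEq E] {p : 𝒢 → ℝ} (hp : p ∈ stdSimplex ℝ 𝒢)
    {g : 𝒢 → Bits n →ₗ[ZMod 2] Bits m} {τ : Bits n → Matrix E E ℂ} {C : ℝ}
    (h : ∀ V : 𝒢 → Bits m → Matrix E E ℂ, (∀ i k, IsContraction (V i k)) →
      hashAdvantage p g V τ ≤ C) :
    d₁ p (keyState p fun i k => ∑ a with g i a = k, τ a) ≤ C := by
  refine d₁_keyState_le hp (fun i => sum_sum_fiber (g i) τ) fun V hV => ?_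
  simp only [sum_fiber_sub_smul_sum]
  exact h V hV

/-- The state of Alice's key `g_i(a)`, Bob's key `g_i(b)`, Eve's system and the public index `i` of
the random hash function, where Eve's state is `τ a b` if the strings are `a` and `b`. -/
def keyPairState (p : 𝒢 → ℝ) (g : 𝒢 → Bits n →ₗ[ZMod 2] Bits m)
    (τ : Bits n → Bits n → Matrix E E ℂ) :
    Matrix (Bits m × Bits m × E × 𝒢) (Bits m × Bits m × E × 𝒢) ℂ :=
  ∑ i, ∑ a, ∑ b, p i • (proj (g i a) ⊗ₖ (proj (g i b) ⊗ₖ (τ a b ⊗ₖ proj i)))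

variable {p : 𝒢 → ℝ} {g : 𝒢 → Bits n →ₗ[ZMod 2] Bits m} {τ : Bits n → Bits n → Matrix E E ℂ}

lemma trSnd_trFst_trFst_keyPairState (hp : p ∈ stdSimplex ℝ 𝒢) :
    trSnd (trFst (trFst (keyPairState p g τ))) = ∑ a, ∑ b, τ a b := by
  simp only [keyPairState, trFst_sum, trFst_smul, trFst_kronecker, trSnd_sum, trSnd_smul,
    trSnd_kronecker, trace_proj, one_smul, ← Finset.smul_sum, ← Finset.sum_smul, hp.2]

/-- The block of `U` at the values `k` and `k'` of the keys and at the index `i`. -/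
def keyPairBlock (U : Matrix (K × K × E × 𝒢) (K × K × E × 𝒢) ℂ) (i : 𝒢) (k k' : K) :
    Matrix E E ℂ :=
  U.submatrix (fun e => (k, k', e, i)) (fun e => (k, k', e, i))

lemma trace_mul_proj_kronecker_proj_kronecker_kronecker_proj
    [Fintype E] (U : Matrix (K × K × E × 𝒢) (K × K × E × 𝒢) ℂ) (k k' : K) (X : Matrix E E ℂ)
    (i : 𝒢) :
    (U * (proj k ⊗ₖ (proj k' ⊗ₖ (X ⊗ₖ proj i)))).trace = (keyPairBlock U i k k' * X).trace := by
  rw [trace_mul_proj_kronecker, trace_mul_proj_kronecker_kronecker_proj]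
  rfl

lemma trace_mul_keyPairState [Fintype E]
    (U : Matrix (Bits m × Bits m × E × 𝒢) (Bits m × Bits m × E × 𝒢) ℂ) :
    (U * keyPairState p g τ).trace.re =
      ∑ i, p i * ∑ a, ∑ b, (keyPairBlock U i (g i a) (g i b) * τ a b).trace.re := by
  simp only [keyPairState, Matrix.mul_smul, Matrix.trace_sum, Matrix.trace_smul,
    trace_mul_proj_kronecker_proj_kronecker_kronecker_proj, Complex.re_sum, Complex.smul_re,
    smul_eq_mul, Finset.mul_sum]

lemma trace_mul_uniform [Fintype E] (U : Matrix (K × K × E × 𝒢) (K × K × E × 𝒢) ℂ) (c : ℝ)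
    (ρ : Matrix E E ℂ) :
    (U * ∑ k, c • (proj k ⊗ₖ (proj k ⊗ₖ (ρ ⊗ₖ hashState p)))).trace.re =
      ∑ i, p i * ∑ k, c * (keyPairBlock U i k k * ρ).trace.re := by
  simp only [hashState, kronecker_sum, Matrix.kronecker_smul, Matrix.mul_smul,
    Matrix.trace_sum, Matrix.trace_smul, Finset.smul_sum,
    trace_mul_proj_kronecker_proj_kronecker_kronecker_proj, Complex.re_sum, Complex.smul_re,
    smul_eq_mul, Finset.mul_sum]
  rw [Finset.sum_comm]
  simp only [mul_left_comm c]

lemma trace_mul_keyPairState_sub_uniform [Fintype E]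
    (U : Matrix (Bits m × Bits m × E × 𝒢) (Bits m × Bits m × E × 𝒢) ℂ) :
    (U * (keyPairState p g τ - ∑ k, (2 : ℝ) ^ (-(m : ℝ)) •
      (proj k ⊗ₖ (proj k ⊗ₖ ((∑ a, ∑ b, τ a b) ⊗ₖ hashState p))))).trace.re =
    ∑ i, p i * ∑ a, ∑ b, ((keyPairBlock U i (g i a) (g i b) * τ a b).trace.re -
      ∑ k, (2 : ℝ) ^ (-(m : ℝ)) * (keyPairBlock U i k k * τ a b).trace.re) := by
  rw [Matrix.mul_sub, Matrix.trace_sub, Complex.sub_re, trace_mul_keyPairState, trace_mul_uniform]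
  simp only [Finset.sum_sub_distrib, mul_sub, Matrix.trace_sum, Complex.re_sum,
    Finset.mul_sum]
  congr 1
  refine Finset.sum_congr rfl fun i _ => ?_
  rw [Finset.sum_comm]
  refine Finset.sum_congr rfl fun a _ => ?_
  rw [Finset.sum_comm]

lemma trace_keyPairBlock_sub_le [Fintype E] [DecidableEq E]
    {U : Matrix (Bits m × Bits m × E × 𝒢) (Bits m × Bits m × E × 𝒢) ℂ} (hU : IsContraction U)
    (i : 𝒢) (k k' : Bits m) {X : Matrix E E ℂ} (hX : X.PosSemidef) :
    (keyPairBlock U i k k' * X).trace.re -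
      ∑ j, (2 : ℝ) ^ (-(m : ℝ)) * (keyPairBlock U i j j * X).trace.re ≤ 2 * X.trace.re := by
  have hblock (k k' : Bits m) : |(keyPairBlock U i k k' * X).trace.re| ≤ X.trace.re :=
    (hU.submatrix fun _ _ => by simp).abs_re_trace_mul_le hX
  have huniform : -X.trace.re ≤
      ∑ j, (2 : ℝ) ^ (-(m : ℝ)) * (keyPairBlock U i j j * X).trace.re :=
    calc -X.trace.re = ∑ _j : Bits m, (2 : ℝ) ^ (-(m : ℝ)) * -X.trace.re := by
          rw [← Finset.sum_mul, sum_bits_two_rpow_neg, one_mul]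
      _ ≤ _ := by
          gcongr with j
          exact (abs_le.1 (hblock j j)).1
  linarith [(abs_le.1 (hblock k k')).2]

/-- The pair of keys fails to be ideal only by the insecurity of Alice's key on the event `a = b`
and by the probability of `a ≠ b`. -/
lemma D₁_keyPairState_le [Fintype E] [DecidableEq E] (hp : p ∈ stdSimplex ℝ 𝒢)
    (hτ : ∀ a b, (τ a b).PosSemidef) {C : ℝ}
    (h : ∀ V : 𝒢 → Bits m → Matrix E E ℂ, (∀ i k, IsContraction (V i k)) →
      hashAdvantage p g V (fun a => τ a a) ≤ C) :
    D₁ p (keyPairState p g τ) ≤ C + 2 * ∑ a, ∑ b with b ≠ a, (τ a b).trace.re := by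
  rw [D₁, trSnd_trFst_trFst_keyPairState hp]
  refine traceNorm_le fun U hU => ?_
  rw [trace_mul_keyPairState_sub_uniform]
  set δ : 𝒢 → Bits n → Bits n → ℝ := fun i a b =>
    (keyPairBlock U i (g i a) (g i b) * τ a b).trace.re -
      ∑ k, (2 : ℝ) ^ (-(m : ℝ)) * (keyPairBlock U i k k * τ a b).trace.re
  have hδ (i : 𝒢) (a b : Bits n) : δ i a b ≤ 2 * (τ a b).trace.re :=
    trace_keyPairBlock_sub_le hU i _ _ (hτ a b)
  have hdiag : ∑ i, p i * ∑ a, δ i a a ≤ C := by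
    rw [← hashAdvantage_eq_sum_sub (fun i k => keyPairBlock U i k k) fun a => τ a a]
    exact h _ fun i k => hU.submatrix fun _ _ => by simp
  have hoff : ∑ i, p i * ∑ a, ∑ b with b ≠ a, δ i a b ≤
      2 * ∑ a, ∑ b with b ≠ a, (τ a b).trace.re :=
    calc ∑ i, p i * ∑ a, ∑ b with b ≠ a, δ i a b
        ≤ ∑ i, p i * ∑ a, ∑ b with b ≠ a, 2 * (τ a b).trace.re := by
          gcongr with i _ a _ b _
          exacts [hp.1 i, hδ i a b]
      _ = _ := by
          rw [← Finset.sum_mul, hp.2, one_mul]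
          simp only [Finset.mul_sum]
  calc ∑ i, p i * ∑ a, ∑ b, δ i a b
      = ∑ i, p i * ∑ a, δ i a a + ∑ i, p i * ∑ a, ∑ b with b ≠ a, δ i a b := by
        simp only [← Finset.sum_add_distrib, ← mul_add, Finset.filter_ne',
          Finset.add_sum_erase _ _ (Finset.mem_univ _)]
    _ ≤ _ := add_le_add hdiag hoff

end KeyStates

section CqState

variable {X E : Type*} [Fintype X] [DecidableEq X]

/-- The classical-quantum state `∑_a |a⟩⟨a| ⊗ τ_a`. -/
def cqState (τ : X → Matrix E E ℂ) : Matrix (X × E) (X × E) ℂ := ∑ a, proj a ⊗ₖ τ a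

lemma cqState_apply (τ : X → Matrix E E ℂ) (x y : X × E) :
    cqState τ x y = if x.1 = y.1 then τ x.1 x.2 y.2 else 0 := by
  rcases x with ⟨a, e⟩
  rcases y with ⟨b, f⟩
  rcases eq_or_ne a b with rfl | h
  · simp [cqState, Matrix.sum_apply, proj_apply]
  · simp [cqState, Matrix.sum_apply, proj_apply, h, h.symm]

lemma diagBlock_cqState (τ : X → Matrix E E ℂ) : diagBlock (cqState τ) = τ := by
  ext a e e'
  simp only [diagBlock, Matrix.submatrix_apply, cqState_apply, if_true]

lemma posSemidef_cqState [Finite E] {τ : X → Matrix E E ℂ} (h : ∀ a, (τ a).PosSemidef) :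
    (cqState τ).PosSemidef :=
  Matrix.posSemidef_sum _ fun a _ => (posSemidef_proj a).kronecker (h a)

lemma cqState_sub (τ τ' : X → Matrix E E ℂ) :
    cqState τ - cqState τ' = cqState fun a => τ a - τ' a := by
  ext
  simp only [Matrix.sub_apply, cqState_apply]
  split_ifs <;> simp

lemma cqState_mono [Finite E] {τ τ' : X → Matrix E E ℂ} (h : ∀ a, τ a ≤ τ' a) :
    cqState τ ≤ cqState τ' := by
  rw [Matrix.le_iff, cqState_sub]
  exact posSemidef_cqState fun a => Matrix.le_iff.1 (h a)

lemma trace_cqState [Fintype E] (τ : X → Matrix E E ℂ) : (cqState τ).trace = ∑ a, (τ a).trace := by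
  simp [Matrix.trace, Fintype.sum_prod_type, cqState_apply]

end CqState

lemma conjTranspose_announce_mul_announce {E T : Type*} [Fintype E] [DecidableEq E] [Fintype T]
    [DecidableEq T] (t : T) : (announce E t)ᴴ * announce E t = 1 := by
  ext e e'
  simp [Matrix.mul_apply, announce, Fintype.sum_prod_type, ite_and, Matrix.one_apply, eq_comm]

lemma kronecker_one_mono {α β : Type*} [Finite α] [Finite β] [DecidableEq β]
    {A B : Matrix α α ℂ} (h : A ≤ B) : A ⊗ₖ (1 : Matrix β β ℂ) ≤ B ⊗ₖ 1 := by
  have hsub : B ⊗ₖ (1 : Matrix β β ℂ) - A ⊗ₖ 1 = (B - A) ⊗ₖ 1 := by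
    rw [sub_eq_iff_eq_add, ← Matrix.add_kronecker, sub_add_cancel]
  rw [Matrix.le_iff, hsub]
  exact (Matrix.le_iff.1 h).kronecker Matrix.PosSemidef.one

namespace Scheme

variable {n m l c : ℕ} {A' B' E T R I J 𝒰 𝒢 : Type*}
  [Fintype A'] [DecidableEq A'] [Fintype B'] [DecidableEq B'] [Fintype E] [DecidableEq E]
  [DecidableEq T] [Fintype R] [Fintype I] [Fintype J] [Fintype 𝒰] [Fintype 𝒢]
  (S : Scheme n m l c A' B' E T R I J 𝒰 𝒢)

lemma posSemidef_sampled [Finite T] : S.sampled.PosSemidef :=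
  Matrix.posSemidef_sum _ fun _ _ => S.ini_sub.1.mul_mul_conjTranspose_same _

variable [Fintype T]

lemma posSemidef_siftedBlock (a b : Bits n) : (S.siftedBlock a b).PosSemidef :=
  posSemidef_trFst <| Matrix.posSemidef_sum _ fun _ _ => Matrix.posSemidef_sum _ fun _ _ =>
    S.posSemidef_sampled.mul_mul_conjTranspose_same _

lemma re_trace_sampled_le : S.sampled.trace.re ≤ 1 := by
  have haccept : ∑ r ∈ S.accept, (S.smp r)ᴴ * S.smp r ≤ 1 := by
    rw [← S.smp_sum]
    exact Finset.sum_le_univ_sum_of_nonneg fun r =>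
      (Matrix.posSemidef_conjTranspose_mul_self (S.smp r)).nonneg
  refine (re_trace_sum_mul_mul_conjTranspose_le ?_ S.ini_sub.1).trans S.ini_sub.2
  calc ∑ r ∈ S.accept, (S.smp r ⊗ₖ announce E (S.ann r))ᴴ * (S.smp r ⊗ₖ announce E (S.ann r))
      = (∑ r ∈ S.accept, (S.smp r)ᴴ * S.smp r) ⊗ₖ (1 : Matrix E E ℂ) := by
        simp only [Matrix.conjTranspose_kronecker, ← Matrix.mul_kronecker_mul,
          conjTranspose_announce_mul_announce, sum_kronecker]
    _ ≤ 1 ⊗ₖ 1 := kronecker_one_mono haccept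
    _ = 1 := Matrix.one_kronecker_one

lemma sum_re_trace_siftedBlock_le : ∑ a, ∑ b, (S.siftedBlock a b).trace.re ≤ 1 := by
  set K : Bits n × I × Bits n × J → Matrix ((A' × B') × (E × T)) ((A' × B') × (E × T)) ℂ :=
    fun x => (S.sifA x.1 x.2.1 ⊗ₖ S.sifB x.2.2.1 x.2.2.2) ⊗ₖ 1
  have hK : ∑ x, (K x)ᴴ * K x = 1 :=
    calc ∑ x, (K x)ᴴ * K x
        = ((∑ a, ∑ i, (S.sifA a i)ᴴ * S.sifA a i) ⊗ₖ (∑ b, ∑ j, (S.sifB b j)ᴴ * S.sifB b j)) ⊗ₖ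
            (1 : Matrix (E × T) (E × T) ℂ) := by
          simp only [K, Fintype.sum_prod_type, Matrix.conjTranspose_kronecker,
            ← Matrix.mul_kronecker_mul, Matrix.conjTranspose_one, Matrix.one_mul, sum_kronecker]
          simp only [kronecker_sum, sum_kronecker]
      _ = 1 := by rw [S.sifA_sum, S.sifB_sum, Matrix.one_kronecker_one, Matrix.one_kronecker_one]
  calc ∑ a, ∑ b, (S.siftedBlock a b).trace.re = (∑ x, K x * S.sampled * (K x)ᴴ).trace.re := by
        simp only [siftedBlock, trace_trFst, Fintype.sum_prod_type, Matrix.trace_sum,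
          Complex.re_sum, K, Finset.sum_comm (γ := Bits n) (α := I)]
    _ ≤ S.sampled.trace.re :=
        re_trace_sum_mul_mul_conjTranspose_le hK.le S.posSemidef_sampled
    _ ≤ 1 := S.re_trace_sampled_le

/-- Eve's sub-normalized state when Alice's sifted key is `a`. -/
def siftedA (a : Bits n) : Matrix (E × T) (E × T) ℂ := ∑ b, S.siftedBlock a b

lemma posSemidef_siftedA (a : Bits n) : (S.siftedA a).PosSemidef :=
  Matrix.posSemidef_sum _ fun _ _ => S.posSemidef_siftedBlock _ _

lemma siftedAE_eq_cqState : S.siftedAE = cqState S.siftedA := by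
  simp only [siftedAE, cqState, siftedA, kronecker_sum]

lemma isSubnormalized_siftedAE : IsSubnormalized S.siftedAE := by
  rw [siftedAE_eq_cqState]
  refine ⟨posSemidef_cqState S.posSemidef_siftedA, ?_⟩
  simpa only [trace_cqState, siftedA, Matrix.trace_sum, Complex.re_sum] using
    S.sum_re_trace_siftedBlock_le

lemma hashAdvantage_le_smoothMinEntropy {ε Hth : ℝ}
    (hSM : (Hth : EReal) ≤ smoothMinEntropy ε S.siftedAE)
    {τ : Bits n → Matrix (E × T) (E × T) ℂ} (hτ : ∀ a, (τ a).PosSemidef)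
    (hτS : ∀ a, τ a ≤ S.siftedA a) {V : 𝒢 → Bits m → Matrix (E × T) (E × T) ℂ}
    (hV : ∀ i k, IsContraction (V i k)) :
    hashAdvantage S.pG S.g V τ ≤ 2 * ε + (2 : ℝ) ^ (((m : ℝ) - Hth + 3) / 2) := by
  rw [← diagBlock_cqState τ]
  exact hashAdvantage_diagBlock_le_smoothMinEntropy S.pG_prob S.g_surj S.g_univ hV
    S.isSubnormalized_siftedAE (posSemidef_cqState hτ)
    (S.siftedAE_eq_cqState ▸ cqState_mono hτS) hSM

end Scheme

section TraceOut

variable {n m : ℕ} {E Z 𝒢 : Type*} [Fintype Z] [Fintype 𝒢] [DecidableEq 𝒢] {p : 𝒢 → ℝ}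
  {g : 𝒢 → Bits n →ₗ[ZMod 2] Bits m}

lemma keyState_sum_fiber (τ : Bits n → Matrix E E ℂ) :
    keyState p (fun i k => ∑ a with g i a = k, τ a) =
      ∑ i, ∑ a, p i • (proj (g i a) ⊗ₖ (τ a ⊗ₖ proj i)) := by
  simp only [keyState, sum_kronecker, kronecker_sum, Finset.smul_sum]
  refine Finset.sum_congr rfl fun i _ => ?_
  rw [← sum_sum_fiber (g i)]
  refine Finset.sum_congr rfl fun k _ => Finset.sum_congr rfl fun a ha => ?_
  rw [(Finset.mem_filter.1 ha).2]

lemma keyPairState_add (τ τ' : Bits n → Bits n → Matrix E E ℂ) :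
    keyPairState p g τ + keyPairState p g τ' = keyPairState p g fun a b => τ a b + τ' a b := by
  simp only [keyPairState, Matrix.add_kronecker, Matrix.kronecker_add, smul_add,
    Finset.sum_add_distrib]

lemma sum_keyPairState_apply (τ : Bits n → Bits n → Matrix (E × Z) (E × Z) ℂ)
    (x y : Bits m × E × 𝒢) :
    ∑ k', ∑ z, keyPairState p g τ (x.1, k', (x.2.1, z), x.2.2) (y.1, k', (y.2.1, z), y.2.2) =
      keyState p (fun i k => ∑ a with g i a = k, ∑ b, trSnd (τ a b)) x y := by
  have hK (k : Bits m) : ∑ k', proj k k' k' = 1 := trace_proj k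
  rw [keyState_sum_fiber]
  simp only [keyPairState, Matrix.sum_apply, Matrix.smul_apply, Matrix.kroneckerMap_apply]
  rw [Finset.sum_comm_cycle]
  refine Finset.sum_congr rfl fun i _ => ?_
  rw [Finset.sum_comm_cycle]
  refine Finset.sum_congr rfl fun a _ => ?_
  rw [Finset.sum_comm_cycle]
  simp only [← Finset.smul_sum, ← Finset.mul_sum, ← Finset.sum_mul, hK, one_mul, trSnd]

end TraceOut

namespace Scheme

variable {n m l c : ℕ} {A' B' E T R I J 𝒰 𝒢 : Type*}
  [Fintype A'] [DecidableEq A'] [Fintype B'] [DecidableEq B'] [Fintype E] [DecidableEq E]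
  [Fintype R] [Fintype I] [Fintype J] [Fintype 𝒰] [Fintype 𝒢]
  (S : Scheme n m l c A' B' E T R I J 𝒰 𝒢)

/-- The probability that the verification function is `u`, that the cipher texts are a given pair,
and that the verification of the keys `a` and `b'` has the outcome `ok`; by the uniformity of the
one-time-pad keys it is the same for all pairs of cipher texts. -/
def publicWeight (ok : Bool) (a b' : Bits n) (u : 𝒰) : ℝ :=
  S.pU u * (2 : ℝ) ^ (-(c : ℝ)) * (2 : ℝ) ^ (-(l : ℝ)) *
    if decide (S.u u a = S.u u b') = ok then 1 else 0

lemma publicWeight_nonneg (ok : Bool) (a b' : Bits n) (u : 𝒰) : 0 ≤ S.publicWeight ok a b' u := by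
  have := S.pU_prob.1 u
  unfold publicWeight
  positivity

lemma sum_publicWeight (ok : Bool) (a b' : Bits n) :
    ∑ z : 𝒰 × Bits c × Bits l, S.publicWeight ok a b' z.1 =
      ∑ u, S.pU u * if decide (S.u u a = S.u u b') = ok then 1 else 0 := by
  simp only [Fintype.sum_prod_type]
  refine Finset.sum_congr rfl fun u _ => ?_
  simp only [publicWeight, mul_right_comm _ _ (ite _ _ _), ← Finset.mul_sum, sum_bits_two_rpow_neg,
    mul_one]

lemma publicWeight_self_mem_stdSimplex (a : Bits n) :
    (fun z => S.publicWeight true a a z.1) ∈ stdSimplex ℝ (𝒰 × Bits c × Bits l) :=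
  ⟨fun z => S.publicWeight_nonneg true a a z.1, by simpa [sum_publicWeight] using S.pU_prob.2⟩

lemma publicWeight_self (a b : Bits n) : S.publicWeight true a a = S.publicWeight true b b := by
  funext u
  simp only [publicWeight]

lemma sum_publicWeight_true_add_false (a b' : Bits n) :
    ∑ z : 𝒰 × Bits c × Bits l, S.publicWeight true a b' z.1 +
      ∑ z : 𝒰 × Bits c × Bits l, S.publicWeight false a b' z.1 = 1 := by
  simp only [sum_publicWeight, ← Finset.sum_add_distrib, ← mul_add]
  refine Eq.trans (Finset.sum_congr rfl fun u _ => ?_) S.pU_prob.2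
  by_cases h : S.u u a = S.u u b' <;> simp [h]

section

variable [DecidableEq 𝒰]

/-- The registers written during the information reconciliation. -/
def publicState (ok : Bool) (a b' : Bits n) :
    Matrix (𝒰 × Bits c × Bits l) (𝒰 × Bits c × Bits l) ℂ :=
  Matrix.diagonal fun z => (S.publicWeight ok a b' z.1 : ℂ)

/-- The message `w` appears on the right only: the cipher texts are independent of it. -/
lemma publicState_eq_sum_proj_add (ok : Bool) (a b' : Bits n) (w : Bits c) :
    S.publicState ok a b' = ∑ u, ∑ x : Bits c, ∑ y : Bits l,
      S.publicWeight ok a b' u • (proj u ⊗ₖ (proj (w + x) ⊗ₖ proj (S.u u a + y))) := by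
  rw [publicState, ← sum_smul_proj, Fintype.sum_prod_type]
  refine Finset.sum_congr rfl fun u _ => ?_
  rw [← Equiv.sum_comp (Equiv.addLeft (w, S.u u a)), Fintype.sum_prod_type]
  simp only [proj_kronecker_proj]
  rfl

end

variable [Fintype T] [DecidableEq T]

/-- Eve's sub-normalized state, before the information reconciliation, when Alice's sifted key is
`a` and Bob's corrected key is `b'`. -/
def correctedBlock (a b' : Bits n) : Matrix (E × T) (E × T) ℂ :=
  ∑ b, ∑ w, S.ec a b (w, b') • S.siftedBlock a b

lemma posSemidef_correctedBlock (a b' : Bits n) : (S.correctedBlock a b').PosSemidef :=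
  Matrix.posSemidef_sum _ fun b _ => Matrix.posSemidef_sum _ fun w _ =>
    (S.posSemidef_siftedBlock a b).smul ((S.ec_prob a b).1 (w, b'))

lemma sum_correctedBlock (a : Bits n) : ∑ b', S.correctedBlock a b' = S.siftedA a := by
  simp only [correctedBlock, siftedA]
  rw [Finset.sum_comm]
  refine Finset.sum_congr rfl fun b _ => ?_
  rw [Finset.sum_comm]
  simp only [← Finset.sum_smul]
  rw [← Fintype.sum_prod_type (f := S.ec a b), (S.ec_prob a b).2, one_smul]

lemma correctedBlock_le_siftedA (a b' : Bits n) : S.correctedBlock a b' ≤ S.siftedA a := by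
  rw [← S.sum_correctedBlock]
  exact Finset.single_le_sum (f := S.correctedBlock a)
    (fun b' _ => (S.posSemidef_correctedBlock a b').nonneg) (Finset.mem_univ b')

variable [DecidableEq 𝒰]

lemma correctedBlock_kronecker_publicState (ok : Bool) (a b' : Bits n) :
    S.correctedBlock a b' ⊗ₖ S.publicState ok a b' =
      ∑ u, ∑ b, ∑ w, ∑ x : Bits c, ∑ y : Bits l,
        (S.ec a b (w, b') * S.publicWeight ok a b' u) •
        (S.siftedBlock a b ⊗ₖ (proj u ⊗ₖ (proj (w + x) ⊗ₖ proj (S.u u a + y)))) := by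
  rw [correctedBlock, sum_kronecker, Finset.sum_comm]
  refine Finset.sum_congr rfl fun b _ => ?_
  rw [sum_kronecker, Finset.sum_comm]
  refine Finset.sum_congr rfl fun w _ => ?_
  rw [S.publicState_eq_sum_proj_add ok a b' w]
  simp only [kronecker_sum, Matrix.smul_kronecker, Matrix.kronecker_smul, smul_smul,
    Finset.smul_sum]

/-- The left side is the probability that the verification misses an error. -/
lemma sum_re_trace_correctedBlock_kronecker_publicState_le :
    ∑ a, ∑ b' with b' ≠ a, (S.correctedBlock a b' ⊗ₖ S.publicState true a b').trace.re ≤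
      (2 : ℝ) ^ (-(l : ℝ)) := by
  have hmiss {a b' : Bits n} (h : b' ≠ a) :
      ∑ z : 𝒰 × Bits c × Bits l, S.publicWeight true a b' z.1 ≤ (2 : ℝ) ^ (-(l : ℝ)) := by
    simpa only [sum_publicWeight, decide_eq_true_eq] using S.u_univ a b' h.symm
  have htrace (a b' : Bits n) : (S.correctedBlock a b' ⊗ₖ S.publicState true a b').trace.re =
      (∑ z : 𝒰 × Bits c × Bits l, S.publicWeight true a b' z.1) *
        (S.correctedBlock a b').trace.re := by
    rw [Matrix.trace_kronecker, publicState, Matrix.trace_diagonal, ← Complex.ofReal_sum,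
      mul_comm, Complex.re_ofReal_mul]
  calc ∑ a, ∑ b' with b' ≠ a, (S.correctedBlock a b' ⊗ₖ S.publicState true a b').trace.re
      ≤ ∑ a, ∑ b' with b' ≠ a, (2 : ℝ) ^ (-(l : ℝ)) * (S.correctedBlock a b').trace.re := by
        gcongr with a _ b' hb'
        rw [htrace]
        exact mul_le_mul_of_nonneg_right (hmiss (Finset.mem_filter.1 hb').2)
          (re_trace_nonneg (S.posSemidef_correctedBlock a b'))
    _ ≤ ∑ a, ∑ b', (2 : ℝ) ^ (-(l : ℝ)) * (S.correctedBlock a b').trace.re := by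
        refine Finset.sum_le_sum fun a _ => Finset.sum_le_univ_sum_of_nonneg fun b' => ?_
        have := re_trace_nonneg (S.posSemidef_correctedBlock a b')
        positivity
    _ = (2 : ℝ) ^ (-(l : ℝ)) * ∑ a, ∑ b, (S.siftedBlock a b).trace.re := by
        simp only [← Finset.mul_sum, ← Complex.re_sum, ← Matrix.trace_sum, sum_correctedBlock,
          siftedA]
    _ ≤ (2 : ℝ) ^ (-(l : ℝ)) :=
        mul_le_of_le_one_right (by positivity) S.sum_re_trace_siftedBlock_le

variable [DecidableEq 𝒢]

lemma finalBranch_eq_keyPairState (ok : Bool) : S.finalBranch ok =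
    keyPairState S.pG S.g fun a b' => S.correctedBlock a b' ⊗ₖ S.publicState ok a b' := by
  simp only [finalBranch, keyPairState, correctedBlock_kronecker_publicState, kronecker_sum,
    sum_kronecker, Matrix.smul_kronecker, Matrix.kronecker_smul, smul_smul, Finset.smul_sum,
    publicWeight, mul_left_comm (S.ec _ _ _), mul_assoc]
  refine Finset.sum_congr rfl fun i _ => ?_
  rw [Finset.sum_comm]
  refine Finset.sum_congr rfl fun a _ => ?_
  rw [Finset.sum_comm (γ := Bits n) (α := 𝒰)]
  refine Finset.sum_congr rfl fun u _ => ?_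
  rw [Finset.sum_comm_cycle]

lemma finalAlice_eq_keyState :
    S.finalAlice = keyState S.pG fun i k => ∑ a with S.g i a = k, S.siftedA a := by
  have htrace (a b' : Bits n) :
      (S.publicState true a b').trace + (S.publicState false a b').trace = 1 := by
    simp only [publicState, Matrix.trace_diagonal]
    exact_mod_cast S.sum_publicWeight_true_add_false a b'
  ext x y
  simp only [finalAlice, finalBranch_eq_keyPairState, keyPairState_add, ← Matrix.kronecker_add]
  rw [sum_keyPairState_apply]
  simp only [trSnd_kronecker, Matrix.trace_add, htrace, one_smul, sum_correctedBlock]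

lemma d₁_finalAlice_le {ε Hth : ℝ} (hSM : (Hth : EReal) ≤ smoothMinEntropy ε S.siftedAE) :
    d₁ S.pG S.finalAlice ≤ 2 * ε + (2 : ℝ) ^ (((m : ℝ) - Hth + 3) / 2) := by
  rw [finalAlice_eq_keyState]
  exact d₁_keyState_hash_le S.pG_prob fun V hV =>
    S.hashAdvantage_le_smoothMinEntropy hSM S.posSemidef_siftedA (fun _ => le_rfl) hV

lemma D₁_final_le {ε Hth : ℝ} (hSM : (Hth : EReal) ≤ smoothMinEntropy ε S.siftedAE) :
    D₁ S.pG S.final ≤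
      (2 : ℝ) ^ (-(l : ℝ) + 1) + 2 * ε + (2 : ℝ) ^ (((m : ℝ) - Hth + 3) / 2) := by
  have hpublic (a b' : Bits n) : (S.publicState true a b').PosSemidef :=
    Matrix.PosSemidef.diagonal fun z => Complex.zero_le_real.2 (S.publicWeight_nonneg true a b' z.1)
  have hτ (a b' : Bits n) : (S.correctedBlock a b' ⊗ₖ S.publicState true a b').PosSemidef :=
    (S.posSemidef_correctedBlock a b').kronecker (hpublic a b')
  have hAlice (V : 𝒢 → Bits m → Matrix _ _ ℂ) (hV : ∀ i k, IsContraction (V i k)) :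
      hashAdvantage S.pG S.g V (fun a => S.correctedBlock a a ⊗ₖ S.publicState true a a) ≤
        2 * ε + (2 : ℝ) ^ (((m : ℝ) - Hth + 3) / 2) := by
    simp only [publicState, S.publicWeight_self _ 0]
    exact hashAdvantage_kronecker_diagonal_le (S.publicWeight_self_mem_stdSimplex 0)
      (fun V hV => S.hashAdvantage_le_smoothMinEntropy hSM
        (fun a => S.posSemidef_correctedBlock a a) (fun a => S.correctedBlock_le_siftedA a a) hV) hV
  rw [final, finalBranch_eq_keyPairState]
  refine (D₁_keyPairState_le S.pG_prob hτ hAlice).trans ?_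
  rw [Real.rpow_add_one two_ne_zero]
  linarith [S.sum_re_trace_correctedBlock_kronecker_publicState_le]

end Scheme

section FiberProj

variable {α β : Type*} [DecidableEq α] [DecidableEq β]

/-- The projection onto the span of the basis vectors `|x⟩` with `f x = y`: the measurement of `f`
in this basis. -/
def fiberProj (f : α → β) (y : β) : Matrix α α ℂ :=
  Matrix.diagonal fun x => if f x = y then 1 else 0

lemma conjTranspose_fiberProj (f : α → β) (y : β) : (fiberProj f y)ᴴ = fiberProj f y := by
  rw [fiberProj, Matrix.diagonal_conjTranspose]
  congr 1
  ext x
  simp [apply_ite]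

lemma sum_fiberProj [Fintype β] (f : α → β) : ∑ y, fiberProj f y = 1 := by
  ext x x'
  by_cases hx : x = x' <;> simp [Matrix.sum_apply, fiberProj, Matrix.one_apply, hx]

lemma fiberProj_kronecker_one {γ : Type*} [DecidableEq γ] (f : α → β) (y : β) :
    fiberProj f y ⊗ₖ (1 : Matrix γ γ ℂ) = fiberProj (fun x : α × γ => f x.1) y := by
  rw [← Matrix.diagonal_one, fiberProj, fiberProj, Matrix.diagonal_kronecker_diagonal]
  simp only [mul_one]

variable [Fintype α]

lemma fiberProj_mul_self (f : α → β) (y : β) : fiberProj f y * fiberProj f y = fiberProj f y := by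
  simp [fiberProj, Matrix.diagonal_mul_diagonal]

lemma fiberProj_mul_of_ne (f : α → β) {y y' : β} (h : y ≠ y') :
    fiberProj f y * fiberProj f y' = 0 := by
  rw [fiberProj, fiberProj, Matrix.diagonal_mul_diagonal, Matrix.diagonal_eq_zero]
  ext x
  by_cases hx : f x = y <;> simp [hx, h]

lemma isContraction_sum_fiberProj_kronecker {γ : Type*} [Fintype β] [Fintype γ] [DecidableEq γ]
    (f : α → β) {V : β → Matrix γ γ ℂ} (hV : ∀ y, IsContraction (V y)) :
    IsContraction (∑ y, fiberProj f y ⊗ₖ V y) := by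
  have hpos (y : β) : (fiberProj f y).PosSemidef := by
    simpa only [conjTranspose_fiberProj, fiberProj_mul_self] using
      Matrix.posSemidef_conjTranspose_mul_self (fiberProj f y)
  have hsq : (∑ y, fiberProj f y ⊗ₖ V y)ᴴ * ∑ y, fiberProj f y ⊗ₖ V y =
      ∑ y, fiberProj f y ⊗ₖ ((V y)ᴴ * V y) := by
    simp only [Matrix.conjTranspose_sum, Finset.sum_mul_sum, Matrix.conjTranspose_kronecker,
      conjTranspose_fiberProj, ← Matrix.mul_kronecker_mul]
    refine Finset.sum_congr rfl fun y _ => ?_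
    rw [Finset.sum_eq_single y, fiberProj_mul_self]
    · intro y' _ hy'
      rw [fiberProj_mul_of_ne f hy'.symm, Matrix.zero_kronecker]
    · simp
  calc (∑ y, fiberProj f y ⊗ₖ V y)ᴴ * ∑ y, fiberProj f y ⊗ₖ V y
      = ∑ y, fiberProj f y ⊗ₖ ((V y)ᴴ * V y) := hsq
    _ ≤ ∑ y, fiberProj f y ⊗ₖ (1 : Matrix γ γ ℂ) := by
        refine Finset.sum_le_sum fun y _ => ?_
        have hdiff : fiberProj f y ⊗ₖ (1 : Matrix γ γ ℂ) - fiberProj f y ⊗ₖ ((V y)ᴴ * V y) =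
            fiberProj f y ⊗ₖ (1 - (V y)ᴴ * V y) := by
          rw [sub_eq_iff_eq_add, ← Matrix.kronecker_add, sub_add_cancel]
        rw [Matrix.le_iff, hdiff]
        exact (hpos y).kronecker (Matrix.le_iff.1 (hV y))
    _ = 1 := by rw [← sum_kronecker, sum_fiberProj, Matrix.one_kronecker_one]

end FiberProj

section Pauli

variable {n m : ℕ}

lemma sign_add (x y z : Bits n) : sign (x + y) z = sign x z * sign y z := by
  simp only [sign, add_dotProduct, ← pow_add]
  rw [ZMod.val_add, ← neg_one_pow_eq_pow_mod_two]

lemma sign_comm (x z : Bits n) : sign x z = sign z x := by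
  rw [sign, sign, dotProduct_comm]

lemma sign_mul_self (x z : Bits n) : sign x z * sign x z = 1 := by
  rw [sign, ← mul_pow]
  simp

lemma star_sign (x z : Bits n) : star (sign x z) = sign x z := by
  simp [sign]

lemma sign_zero_left (z : Bits n) : sign 0 z = 1 := by
  simp [sign]

lemma sign_eq_neg_one {x z : Bits n} (h : x ⬝ᵥ z ≠ 0) : sign x z = -1 := by
  have hone : ∀ a : ZMod 2, a ≠ 0 → a = 1 := by decide
  simp [sign, hone _ h, ZMod.val_one]

lemma sum_filter_sign_eq_zero (P : Bits n → Prop) [DecidablePred P] {r z : Bits n}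
    (hP : ∀ x, P (x + r) ↔ P x) (h : r ⬝ᵥ z ≠ 0) : ∑ x with P x, sign x z = 0 := by
  have hflip : ∑ x with P x, sign x z = -∑ x with P x, sign x z := by
    simp only [Finset.sum_filter]
    conv_lhs => rw [← Equiv.sum_comp (Equiv.addRight r)]
    rw [← Finset.sum_neg_distrib]
    refine Finset.sum_congr rfl fun x _ => ?_
    rw [Equiv.coe_addRight, sign_add, sign_eq_neg_one h, mul_neg_one, if_congr (hP x) rfl rfl]
    split_ifs <;> simp
  exact self_eq_neg.1 hflip

lemma phaseKet_mul_star (x y z z' : Bits n) :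
    phaseKet x z * star (phaseKet y z') = ((2 : ℝ) ^ (-(n : ℝ)) : ℝ) * (sign x z * sign y z') := by
  have hsq : (2 : ℝ) ^ (-(n : ℝ)) = (2 : ℝ) ^ (-(n : ℝ) / 2) * (2 : ℝ) ^ (-(n : ℝ) / 2) := by
    rw [← Real.rpow_add two_pos, add_halves]
  rw [hsq, phaseKet, phaseKet, star_mul', star_sign, RCLike.star_def, Complex.conj_ofReal,
    Complex.ofReal_mul]
  ring

/-- The unitary matrix whose columns are the phase basis vectors `|x̃⟩`. -/
def phaseBasis (n : ℕ) : Matrix (Bits n) (Bits n) ℂ := Matrix.of fun z x => phaseKet x z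

lemma phaseBasis_mul_conjTranspose : phaseBasis n * (phaseBasis n)ᴴ = 1 := by
  ext z z'
  have hentry : (phaseBasis n * (phaseBasis n)ᴴ) z z' =
      ((2 : ℝ) ^ (-(n : ℝ)) : ℝ) * ∑ x, sign x (z + z') := by
    simp only [Matrix.mul_apply, Matrix.conjTranspose_apply, phaseBasis, Matrix.of_apply,
      phaseKet_mul_star, Finset.mul_sum, sign_comm _ (z + z'), sign_add, sign_comm z,
      sign_comm z']
  rw [hentry]
  by_cases hz : z = z'
  · have hone : ((2 : ℝ) ^ (-(n : ℝ)) : ℝ) * (2 : ℂ) ^ n = 1 := by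
      exact_mod_cast two_rpow_neg_mul_two_pow n
    rw [hz, ZModModule.add_self, Matrix.one_apply_eq, ← hone]
    simp [sign_comm _ 0, sign_zero_left]
  · obtain ⟨i, hi⟩ := Function.ne_iff.1 hz
    have hdot : Pi.single i 1 ⬝ᵥ (z + z') ≠ 0 := by
      rwa [single_one_dotProduct, Pi.add_apply, Ne, CharTwo.add_eq_zero]
    have hsum := sum_filter_sign_eq_zero (fun _ => True) (fun _ => Iff.rfl) hdot
    rw [Finset.filter_true] at hsum
    rw [hsum, mul_zero, Matrix.one_apply_ne hz]

lemma phaseBasis_conjTranspose_mul : (phaseBasis n)ᴴ * phaseBasis n = 1 :=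
  mul_eq_one_comm.1 phaseBasis_mul_conjTranspose

variable (h : Matrix (Fin (n - m)) (Fin n) (ZMod 2)) (s : Bits (n - m))

lemma syndromeProj_eq_conj :
    syndromeProj h s = phaseBasis n * fiberProj (h *ᵥ ·) s * (phaseBasis n)ᴴ := by
  ext z z'
  rw [syndromeProj, Matrix.sum_apply, Matrix.mul_apply]
  refine Finset.sum_congr rfl fun x _ => ?_
  rw [fiberProj, Matrix.mul_diagonal]
  split_ifs <;> simp [pureState, Matrix.vecMulVec_apply, phaseBasis]

lemma syndromeProj_mul_self : syndromeProj h s * syndromeProj h s = syndromeProj h s := by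
  simp only [syndromeProj_eq_conj]
  calc phaseBasis n * fiberProj (h *ᵥ ·) s * (phaseBasis n)ᴴ *
        (phaseBasis n * fiberProj (h *ᵥ ·) s * (phaseBasis n)ᴴ)
      = phaseBasis n * (fiberProj (h *ᵥ ·) s *
          (((phaseBasis n)ᴴ * phaseBasis n) * fiberProj (h *ᵥ ·) s)) * (phaseBasis n)ᴴ := by
        simp only [Matrix.mul_assoc]
    _ = phaseBasis n * fiberProj (h *ᵥ ·) s * (phaseBasis n)ᴴ := by
        rw [phaseBasis_conjTranspose_mul, Matrix.one_mul, fiberProj_mul_self]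

lemma conjTranspose_syndromeProj : (syndromeProj h s)ᴴ = syndromeProj h s := by
  rw [syndromeProj_eq_conj, Matrix.conjTranspose_mul, Matrix.conjTranspose_mul,
    Matrix.conjTranspose_conjTranspose, conjTranspose_fiberProj, Matrix.mul_assoc]

lemma sum_syndromeProj : ∑ s, syndromeProj h s = 1 := by
  simp only [syndromeProj_eq_conj, ← Finset.sum_mul, ← Finset.mul_sum]
  rw [sum_fiberProj, Matrix.mul_one, phaseBasis_mul_conjTranspose]

lemma syndromeProj_apply (z z' : Bits n) :
    syndromeProj h s z z' =
      ((2 : ℝ) ^ (-(n : ℝ)) : ℝ) * ∑ x with h *ᵥ x = s, sign x (z + z') := by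
  rw [syndromeProj, Matrix.sum_apply, Finset.mul_sum, Finset.sum_filter]
  refine Finset.sum_congr rfl fun x _ => ?_
  split_ifs
  · rw [pureState, Matrix.vecMulVec_apply, Pi.star_apply, phaseKet_mul_star, sign_comm x (z + z'),
      sign_add, sign_comm z, sign_comm z']
  · rfl

variable {h} {g : Bits n →ₗ[ZMod 2] Bits m}

/-- The stabilizers `X^{h_j}` and `Z^{g_i}` commute: a row of `g` lies in the kernel of `h`, so
translating by it makes the matrix entries of the syndrome projection between strings with different
hash values cancel. -/
lemma bitProj_mul_syndromeProj (hg : h * (LinearMap.toMatrix' g)ᵀ = 0) (k : Bits m) :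
    bitProj g k * syndromeProj h s = syndromeProj h s * bitProj g k := by
  ext z z'
  rw [bitProj, Matrix.diagonal_mul, Matrix.mul_diagonal]
  by_cases hz : g z = g z'
  · rw [hz, mul_comm]
  obtain ⟨i, hi⟩ := Function.ne_iff.1 hz
  set r : Bits n := LinearMap.toMatrix' g i
  have hhr : h *ᵥ r = 0 := by
    ext j
    exact congrFun (congrFun hg j) i
  have hrz : r ⬝ᵥ (z + z') ≠ 0 := by
    have hr (v : Bits n) : r ⬝ᵥ v = g v i := congrFun (LinearMap.toMatrix'_mulVec g v) i
    rwa [hr, map_add, Pi.add_apply, Ne, CharTwo.add_eq_zero]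
  have hzero : syndromeProj h s z z' = 0 := by
    rw [syndromeProj_apply, sum_filter_sign_eq_zero _ (fun x => ?_) hrz, mul_zero]
    rw [Matrix.mulVec_add, hhr, add_zero]
  rw [hzero, mul_zero, zero_mul]

lemma conjTranspose_pauliZ_mul_bitProj_mul_pauliZ (k : Bits m) (e : Bits n) :
    (pauliZ e)ᴴ * bitProj g k * pauliZ e = bitProj g k := by
  rw [pauliZ, bitProj, Matrix.diagonal_conjTranspose, Matrix.diagonal_mul_diagonal,
    Matrix.diagonal_mul_diagonal]
  congr 1
  ext z
  rw [Pi.star_apply, star_sign, mul_right_comm, sign_mul_self, one_mul]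

lemma star_phaseKet_dotProduct_bitProj_mulVec (hg : Function.Surjective g) (k : Bits m) :
    star (phaseKet (0 : Bits n)) ⬝ᵥ (bitProj g k *ᵥ phaseKet 0) =
      ((2 : ℝ) ^ (-(m : ℝ)) : ℝ) := by
  have hterm (a : Bits n) : star (phaseKet (0 : Bits n)) a * (bitProj g k *ᵥ phaseKet 0) a =
      ((2 : ℝ) ^ (-(n : ℝ)) : ℝ) * ((if g a = k then (1 : ℝ) else 0 : ℝ) : ℂ) := by
    have hnorm := phaseKet_mul_star (0 : Bits n) 0 a a
    rw [sign_mul_self, mul_one] at hnorm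
    rw [bitProj, Matrix.mulVec_diagonal, Pi.star_apply, ← hnorm]
    split_ifs <;> push_cast <;> ring
  simp only [dotProduct, hterm]
  rw [← Finset.mul_sum, ← Complex.ofReal_sum, sum_indicator_fiber_eq g hg, ← Complex.ofReal_mul,
    ← mul_assoc, two_rpow_neg_mul_two_pow, one_mul]

end Pauli

section GentleMeasurement

open scoped Matrix.Norms.Frobenius

variable {α : Type*} [Fintype α] [DecidableEq α] {Q V V₀ V₁ ω : Matrix α α ℂ}

lemma isContraction_of_isStarProjection (hQ : IsStarProjection Q) : IsContraction Q := by
  have hQQ : Qᴴ * Q = Q := by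
    rw [← Matrix.star_eq_conjTranspose, hQ.isSelfAdjoint.star_eq, hQ.isIdempotentElem.eq]
  have hPP : (1 - Q)ᴴ * (1 - Q) = 1 - Q := by
    rw [← Matrix.star_eq_conjTranspose, hQ.one_sub.isSelfAdjoint.star_eq,
      hQ.one_sub.isIdempotentElem.eq]
  rw [IsContraction, hQQ, Matrix.le_iff, ← hPP]
  exact Matrix.posSemidef_conjTranspose_mul_self _

lemma sub_eq_add_add_sub_of_mul_eq_mul (hQ : IsStarProjection Q) (hQVQ : Q * V₁ * Q = Q * V₀ * Q)
    (hcomm : Commute V₀ Q) :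
    V₁ - V₀ = (1 - Q) * V₁ * Q + Q * V₁ * (1 - Q) + (1 - Q) * V₁ * (1 - Q) -
      (1 - Q) * V₀ * (1 - Q) := by
  have hV₀ : Q * V₀ * Q = V₀ * Q := by rw [← hcomm.eq, Matrix.mul_assoc, hQ.isIdempotentElem.eq]
  rw [hV₀] at hQVQ
  simp only [Matrix.sub_mul, Matrix.mul_sub, Matrix.one_mul, Matrix.mul_one, hQVQ, hV₀, hcomm.eq]
  abel

lemma re_trace_mul_mul_mul_sqrt_le (hV : IsContraction V) {P : Matrix α α ℂ}
    (hP : P.IsHermitian) (hω : ω.PosSemidef) :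
    (P * V * Q * ω).trace.re ≤ ‖Q * CFC.sqrt ω‖ * ‖P * CFC.sqrt ω‖ := by
  set R := CFC.sqrt ω with hR
  have hRR : R * Rᴴ = ω := by
    rw [hR, (isHermitian_sqrt ω).eq, CFC.sqrt_mul_sqrt_self ω hω.nonneg]
  have htrace : (P * V * Q * ω).trace = (V * (Q * R * (P * R)ᴴ)).trace := by
    rw [← hRR, Matrix.conjTranspose_mul, hP.eq, Matrix.mul_assoc P, Matrix.mul_assoc P,
      Matrix.trace_mul_comm]
    simp only [Matrix.mul_assoc]
  rw [htrace, ← Matrix.frobenius_norm_conjTranspose (P * R)]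
  exact hV.re_trace_mul_mul_le _ _

lemma norm_mul_sqrt_sq (hQ : IsStarProjection Q) (hω : ω.PosSemidef) :
    ‖Q * CFC.sqrt ω‖ ^ 2 = (Q * ω).trace.re := by
  have hQH : Qᴴ = Q := hQ.isSelfAdjoint.star_eq
  rw [frobenius_norm_sq, Matrix.conjTranspose_mul, hQH, Matrix.mul_assoc, ← Matrix.mul_assoc Q Q,
    hQ.isIdempotentElem.eq, Matrix.trace_mul_comm, Matrix.mul_assoc, (isHermitian_sqrt ω).eq,
    CFC.sqrt_mul_sqrt_self ω hω.nonneg]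

/-- Off the block of `Q`, the state `ω` has weight at most `1 - Tr Qω`, so two contractions which
agree on that block are hard to tell apart; `V₀` commuting with `Q` halves the bound, as its cross
terms vanish. -/
lemma re_trace_sub_mul_le (hQ : IsStarProjection Q) (hV₁ : IsContraction V₁)
    (hV₀ : IsContraction V₀) (hQVQ : Q * V₁ * Q = Q * V₀ * Q) (hcomm : Commute V₀ Q)
    (hω : IsSubnormalized ω) :
    ((V₁ - V₀) * ω).trace.re ≤ 2 * √2 * √(1 - (Q * ω).trace.re) := by
  set t := ‖Q * CFC.sqrt ω‖
  set s := ‖(1 - Q) * CFC.sqrt ω‖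
  have ht : t ^ 2 = (Q * ω).trace.re := norm_mul_sqrt_sq hQ hω.1
  have hs : s ^ 2 ≤ 1 - (Q * ω).trace.re := by
    have hsub : ((1 - Q) * ω).trace.re = ω.trace.re - (Q * ω).trace.re := by
      rw [Matrix.sub_mul, Matrix.one_mul, Matrix.trace_sub, Complex.sub_re]
    have htrace : s ^ 2 = ((1 - Q) * ω).trace.re := norm_mul_sqrt_sq hQ.one_sub hω.1
    linarith [hω.2]
  have _ : 0 ≤ s := norm_nonneg _
  have hsplit : ((V₁ - V₀) * ω).trace.re = ((1 - Q) * V₁ * Q * ω).trace.re +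
      (Q * V₁ * (1 - Q) * ω).trace.re + ((1 - Q) * V₁ * (1 - Q) * ω).trace.re +
      ((1 - Q) * -V₀ * (1 - Q) * ω).trace.re := by
    rw [sub_eq_add_add_sub_of_mul_eq_mul hQ hQVQ hcomm]
    simp only [Matrix.add_mul, Matrix.trace_add, Complex.add_re, Matrix.mul_neg, Matrix.neg_mul,
      Matrix.trace_neg, Complex.neg_re, sub_eq_add_neg]
  have hQH : Q.IsHermitian := hQ.isSelfAdjoint
  have hPH : (1 - Q).IsHermitian := hQ.one_sub.isSelfAdjoint
  have hPQ := re_trace_mul_mul_mul_sqrt_le (Q := Q) hV₁ hPH hω.1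
  have hQP := re_trace_mul_mul_mul_sqrt_le (Q := 1 - Q) hV₁ hQH hω.1
  have hPP := re_trace_mul_mul_mul_sqrt_le (Q := 1 - Q) hV₁ hPH hω.1
  have hPP₀ := re_trace_mul_mul_mul_sqrt_le (Q := 1 - Q) hV₀.neg hPH hω.1
  have hst : s + t ≤ √2 := Real.le_sqrt_of_sq_le (by nlinarith [sq_nonneg (s - t)])
  calc ((V₁ - V₀) * ω).trace.re ≤ t * s + s * t + s * s + s * s := by rw [hsplit]; gcongr
    _ = 2 * (s + t) * s := by ring
    _ ≤ 2 * √2 * √(1 - (Q * ω).trace.re) := by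
        gcongr
        exact Real.le_sqrt_of_sq_le hs

end GentleMeasurement

section PhaseError

variable {α F : Type*}

lemma posSemidef_pureState [Finite α] (v : α → ℂ) : (pureState v).PosSemidef :=
  Matrix.posSemidef_vecMulVec_self_star v

variable [Fintype α] [Fintype F]

lemma pureState_mul_mul_pureState (v : α → ℂ) (M : Matrix α α ℂ) :
    pureState v * M * pureState v = (star v ⬝ᵥ (M *ᵥ v)) • pureState v := by
  rw [pureState, Matrix.vecMulVec_mul, Matrix.vecMulVec_mul_vecMulVec, Matrix.vecMulVec_smul,
    Matrix.dotProduct_mulVec]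

lemma trace_pureState_mul (v : α → ℂ) (M : Matrix α α ℂ) :
    (pureState v * M).trace = star v ⬝ᵥ (M *ᵥ v) := by
  rw [pureState, Matrix.vecMulVec_mul, Matrix.trace_vecMulVec, dotProduct_comm,
    Matrix.dotProduct_mulVec]

lemma isStarProjection_pureState {v : α → ℂ} (hv : star v ⬝ᵥ v = 1) :
    IsStarProjection (pureState v) where
  isIdempotentElem := by
    classical
    have hsq := pureState_mul_mul_pureState v 1
    rwa [Matrix.mul_one, Matrix.one_mulVec, hv, one_smul] at hsq
  isSelfAdjoint := (posSemidef_pureState v).isHermitian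

lemma isStarProjection_kronecker_one [DecidableEq F] {P : Matrix α α ℂ} (hP : IsStarProjection P) :
    IsStarProjection (P ⊗ₖ (1 : Matrix F F ℂ)) where
  isIdempotentElem := by
    rw [IsIdempotentElem, ← Matrix.mul_kronecker_mul, hP.isIdempotentElem.eq, Matrix.one_mul]
  isSelfAdjoint := by
    rw [IsSelfAdjoint, Matrix.star_eq_conjTranspose, Matrix.conjTranspose_kronecker,
      ← Matrix.star_eq_conjTranspose P, hP.isSelfAdjoint.star_eq, Matrix.conjTranspose_one]

variable {n m : ℕ}

lemma star_phaseKet_dotProduct_phaseKet (x : Bits n) : star (phaseKet x) ⬝ᵥ phaseKet x = 1 := by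
  have hdiag := congrFun (congrFun (phaseBasis_conjTranspose_mul (n := n)) x) x
  rwa [Matrix.one_apply_eq] at hdiag

variable {g : Bits n →ₗ[ZMod 2] Bits m} [DecidableEq F]

/-- The phase state `|0̃⟩` gives every hash value the same probability `2^{-m}`. -/
lemma phaseProj_mul_mul_phaseProj (hg : Function.Surjective g) (V : Bits m → Matrix F F ℂ) :
    (pureState (phaseKet 0) ⊗ₖ (1 : Matrix F F ℂ)) * (∑ k, bitProj g k ⊗ₖ V k) *
        (pureState (phaseKet 0) ⊗ₖ (1 : Matrix F F ℂ)) =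
      (pureState (phaseKet 0) ⊗ₖ (1 : Matrix F F ℂ)) *
          ((1 : Matrix (Bits n) (Bits n) ℂ) ⊗ₖ ∑ k, (2 : ℝ) ^ (-(m : ℝ)) • V k) *
        (pureState (phaseKet 0) ⊗ₖ (1 : Matrix F F ℂ)) := by
  have hproj := isStarProjection_pureState (star_phaseKet_dotProduct_phaseKet (0 : Bits n))
  simp only [kronecker_sum, Finset.mul_sum, Finset.sum_mul, Matrix.kronecker_smul,
    Matrix.mul_smul, Matrix.smul_mul, ← Matrix.mul_kronecker_mul, Matrix.one_mul, Matrix.mul_one,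
    pureState_mul_mul_pureState, star_phaseKet_dotProduct_bitProj_mulVec hg,
    Matrix.smul_kronecker, hproj.isIdempotentElem.eq, Complex.coe_smul]

lemma sum_re_trace_bitProj_sub_le (hg : Function.Surjective g) {V : Bits m → Matrix F F ℂ}
    (hV : ∀ k, IsContraction (V k)) {ω : Matrix (Bits n × F) (Bits n × F) ℂ}
    (hω : IsSubnormalized ω) :
    ∑ k, (((bitProj g k ⊗ₖ V k) * ω).trace.re - (2 : ℝ) ^ (-(m : ℝ)) *
        (((1 : Matrix (Bits n) (Bits n) ℂ) ⊗ₖ V k) * ω).trace.re) ≤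
      2 * √2 * √(1 - (star (phaseKet 0) ⬝ᵥ (trSnd ω *ᵥ phaseKet 0)).re) := by
  have hproj := isStarProjection_pureState (star_phaseKet_dotProduct_phaseKet (0 : Bits n))
  have huniform : (fun _ => (2 : ℝ) ^ (-(m : ℝ))) ∈ stdSimplex ℝ (Bits m) :=
    ⟨fun _ => by positivity, sum_bits_two_rpow_neg m⟩
  rw [← trace_pureState_mul, ← trace_kronecker_one_mul]
  refine le_trans (le_of_eq ?_) (re_trace_sub_mul_le (isStarProjection_kronecker_one hproj)
    (isContraction_sum_fiberProj_kronecker g hV)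
    (isContraction_one.kronecker (IsContraction.sum_smul huniform hV))
    (phaseProj_mul_mul_phaseProj hg V) ?_ hω)
  · simp only [Finset.sum_sub_distrib, kronecker_sum, Matrix.kronecker_smul, Matrix.sub_mul,
      Finset.sum_mul, Matrix.smul_mul, Matrix.trace_sub, Matrix.trace_sum, Matrix.trace_smul,
      Complex.sub_re, Complex.re_sum, Complex.smul_re, smul_eq_mul]
    rfl
  · simp only [Commute, SemiconjBy, ← Matrix.mul_kronecker_mul, Matrix.one_mul, Matrix.mul_one]

lemma re_star_phaseKet_dotProduct_le_one {κ : Type*} [Fintype κ]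
    {ω : Matrix (Bits n × κ) (Bits n × κ) ℂ}
    (hω : IsSubnormalized ω) : (star (phaseKet 0) ⬝ᵥ (trSnd ω *ᵥ phaseKet 0)).re ≤ 1 := by
  classical
  have hproj := isStarProjection_pureState (star_phaseKet_dotProduct_phaseKet (0 : Bits n))
  rw [← trace_pureState_mul, ← trace_kronecker_one_mul]
  exact (le_abs_self _).trans (((isContraction_of_isStarProjection
    (isStarProjection_kronecker_one hproj)).abs_re_trace_mul_le hω.1).trans hω.2)

end PhaseError

section PhaseErrorCorrection

variable {n m : ℕ} {E C : Type*} [Fintype E] [DecidableEq E] [Fintype C] [DecidableEq C]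

/-- The unnormalized state of Eve for the hash value `k` in the bit basis. -/
def hashBlock (g : Bits n →ₗ[ZMod 2] Bits m) (k : Bits m)
    (ρ : Matrix (Bits n × E × C) (Bits n × E × C) ℂ) : Matrix E E ℂ :=
  trSnd (trFst ((bitProj g k ⊗ₖ (1 : Matrix (E × C) (E × C) ℂ)) * ρ *
    (bitProj g k ⊗ₖ (1 : Matrix (E × C) (E × C) ℂ))))

variable {g : Bits n →ₗ[ZMod 2] Bits m} {ρ : Matrix (Bits n × E × C) (Bits n × E × C) ℂ}

lemma trace_mul_hashBlock (k : Bits m) (Y : Matrix E E ℂ) :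
    (Y * hashBlock g k ρ).trace = ((bitProj g k ⊗ₖ (Y ⊗ₖ (1 : Matrix C C ℂ))) * ρ).trace := by
  rw [hashBlock, ← trace_kronecker_one_mul, ← trace_one_kronecker_mul, ← Matrix.mul_assoc,
    Matrix.trace_mul_comm, ← Matrix.mul_assoc, ← Matrix.mul_assoc, ← Matrix.mul_kronecker_mul,
    ← Matrix.mul_kronecker_mul, Matrix.one_mul, Matrix.mul_one, Matrix.mul_one]
  exact congrArg (fun P => ((P ⊗ₖ (Y ⊗ₖ (1 : Matrix C C ℂ))) * ρ).trace) (fiberProj_mul_self g k)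

lemma sum_hashBlock : ∑ k, hashBlock g k ρ = trSnd (trFst ρ) := by
  rw [Matrix.ext_iff_trace_mul_left]
  intro Y
  have hsum : ∑ k, bitProj g k = 1 := sum_fiberProj g
  rw [← trace_kronecker_one_mul, ← trace_one_kronecker_mul, ← hsum, sum_kronecker,
    Finset.sum_mul, Matrix.trace_sum, Finset.mul_sum, Matrix.trace_sum]
  exact Finset.sum_congr rfl fun k _ => trace_mul_hashBlock k Y

lemma hashBlock_pureState (k : Bits m) (ψ : Bits n × E × C → ℂ) :
    hashBlock g k (pureState ψ) = ∑ a with g a = k, diagBlock (reducedAE ψ) a := by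
  have hblock : bitProj g k ⊗ₖ (1 : Matrix (E × C) (E × C) ℂ) = fiberProj (fun x => g x.1) k :=
    fiberProj_kronecker_one g k
  ext e e'
  simp only [hashBlock, hblock, fiberProj, trSnd, trFst, Matrix.mul_diagonal,
    Matrix.diagonal_mul, Matrix.sum_apply, diagBlock, Matrix.submatrix_apply, reducedAE,
    mul_ite, ite_mul, one_mul, mul_one, zero_mul, mul_zero, ← ite_and, and_self]
  rw [Finset.sum_comm, Finset.sum_filter]
  refine Finset.sum_congr rfl fun a _ => ?_
  split_ifs <;> simp

variable {h : Matrix (Fin (n - m)) (Fin n) (ZMod 2)} {M : Bits (n - m) → Bits n → Matrix C C ℂ}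

lemma conjTranspose_mul_bitProj_mul (hg : h * (LinearMap.toMatrix' g)ᵀ = 0) (k : Bits m)
    (s : Bits (n - m)) (e : Bits n) :
    (pauliZ e * syndromeProj h s)ᴴ * bitProj g k * (pauliZ e * syndromeProj h s) =
      bitProj g k * syndromeProj h s := by
  calc (pauliZ e * syndromeProj h s)ᴴ * bitProj g k * (pauliZ e * syndromeProj h s)
      = syndromeProj h s * ((pauliZ e)ᴴ * bitProj g k * pauliZ e) * syndromeProj h s := by
        rw [Matrix.conjTranspose_mul, conjTranspose_syndromeProj]
        simp only [Matrix.mul_assoc]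
    _ = bitProj g k * syndromeProj h s := by
        rw [conjTranspose_pauliZ_mul_bitProj_mul_pauliZ, ← bitProj_mul_syndromeProj s hg,
          Matrix.mul_assoc, syndromeProj_mul_self]

/-- Phase error correction in the Heisenberg picture. -/
lemma sum_conjTranspose_mul_bitProj_kronecker_mul (hg : h * (LinearMap.toMatrix' g)ᵀ = 0)
    (hM : ∀ s, ∑ e, (M s e)ᴴ * M s e = 1) (k : Bits m) (Y : Matrix E E ℂ) :
    ∑ s, ∑ e, ((pauliZ e * syndromeProj h s) ⊗ₖ ((1 : Matrix E E ℂ) ⊗ₖ M s e))ᴴ *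
        (bitProj g k ⊗ₖ (Y ⊗ₖ (1 : Matrix C C ℂ))) *
        ((pauliZ e * syndromeProj h s) ⊗ₖ ((1 : Matrix E E ℂ) ⊗ₖ M s e)) =
      bitProj g k ⊗ₖ (Y ⊗ₖ (1 : Matrix C C ℂ)) := by
  simp only [Matrix.conjTranspose_kronecker, Matrix.conjTranspose_one, ← Matrix.mul_kronecker_mul,
    conjTranspose_mul_bitProj_mul hg, Matrix.one_mul, Matrix.mul_one, ← kronecker_sum, hM]
  rw [← sum_kronecker, ← Finset.mul_sum, sum_syndromeProj, Matrix.mul_one]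

lemma hashBlock_pec (hg : h * (LinearMap.toMatrix' g)ᵀ = 0)
    (hM : ∀ s, ∑ e, (M s e)ᴴ * M s e = 1) (k : Bits m) :
    hashBlock g k (pec h M ρ) = hashBlock g k ρ := by
  rw [Matrix.ext_iff_trace_mul_left]
  intro Y
  rw [trace_mul_hashBlock, trace_mul_hashBlock]
  conv_rhs => rw [← sum_conjTranspose_mul_bitProj_kronecker_mul hg hM k Y]
  simp only [pec, Finset.mul_sum, Finset.sum_mul, Matrix.trace_sum]
  refine Finset.sum_congr rfl fun s _ => Finset.sum_congr rfl fun e _ => ?_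
  rw [← Matrix.mul_assoc, Matrix.trace_mul_comm]
  simp only [Matrix.mul_assoc]

lemma trSnd_trFst_pec (hg : h * (LinearMap.toMatrix' g)ᵀ = 0)
    (hM : ∀ s, ∑ e, (M s e)ᴴ * M s e = 1) : trSnd (trFst (pec h M ρ)) = trSnd (trFst ρ) := by
  rw [← sum_hashBlock (g := g), ← sum_hashBlock (g := g)]
  exact Finset.sum_congr rfl fun k _ => hashBlock_pec hg hM k

lemma isSubnormalized_pec (hg : h * (LinearMap.toMatrix' g)ᵀ = 0)
    (hM : ∀ s, ∑ e, (M s e)ᴴ * M s e = 1) (hρ : IsSubnormalized ρ) :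
    IsSubnormalized (pec h M ρ) := by
  refine ⟨Matrix.posSemidef_sum _ fun _ _ => Matrix.posSemidef_sum _ fun _ _ =>
    hρ.1.mul_mul_conjTranspose_same _, ?_⟩
  rw [← trace_trFst, ← trace_trSnd, trSnd_trFst_pec hg hM, trace_trSnd, trace_trFst]
  exact hρ.2

lemma sum_re_trace_hashBlock_sub_le (hg : Function.Surjective g) {V : Bits m → Matrix E E ℂ}
    (hV : ∀ k, IsContraction (V k)) (hρ : IsSubnormalized ρ) :
    ∑ k, (V k * (hashBlock g k ρ - (2 : ℝ) ^ (-(m : ℝ)) • trSnd (trFst ρ))).trace.re ≤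
      2 * √2 * √(phaseError ρ) := by
  refine le_of_eq_of_le (Finset.sum_congr rfl fun k _ => ?_) (sum_re_trace_bitProj_sub_le hg
    (fun k => (hV k).kronecker (isContraction_one (α := C))) hρ)
  rw [Matrix.mul_sub, Matrix.mul_smul, Matrix.trace_sub, Matrix.trace_smul, trace_mul_hashBlock,
    ← trace_kronecker_one_mul, ← trace_one_kronecker_mul, Complex.sub_re, Complex.smul_re,
    smul_eq_mul]

end PhaseErrorCorrection

section Twirl

variable {n : ℕ} {E C : Type*}

lemma zMeasure_eq_cqState [Fintype E] [DecidableEq E]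
    (ρ : Matrix (Bits n × E) (Bits n × E) ℂ) : zMeasure ρ = cqState (diagBlock ρ) := by
  have hproj (z : Bits n) : proj z ⊗ₖ (1 : Matrix E E ℂ) =
      Matrix.diagonal fun x => if z = x.1 then 1 else 0 := by
    rw [proj, ← Matrix.diagonal_single, ← Matrix.diagonal_one,
      Matrix.diagonal_kronecker_diagonal]
    simp only [Pi.single_apply, mul_one, eq_comm]
  ext ⟨a, e⟩ ⟨a', e'⟩
  rw [cqState_apply]
  simp only [zMeasure, hproj, Matrix.sum_apply, Matrix.mul_diagonal, Matrix.diagonal_mul, ite_mul,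
    one_mul, zero_mul, mul_ite, mul_one, mul_zero, Finset.sum_ite_eq', Finset.mem_univ, if_true,
    diagBlock, Matrix.submatrix_apply]
  rcases eq_or_ne a a' with rfl | h
  · simp only [if_true]
  · simp only [h, h.symm, if_false]

lemma twirl_apply (φ : Bits n × E × C → ℂ) (a : Bits n) (e : E) (z : C) (t : Bits n) :
    twirl φ (a, e, (z, t)) = if t = a then φ (a, e, z) else 0 := by
  simp [twirl, pauliX]

lemma reducedAE_twirl [Fintype E] [DecidableEq E] [Fintype C] (φ : Bits n × E × C → ℂ) :
    reducedAE (twirl φ) = zMeasure (reducedAE φ) := by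
  ext ⟨a, e⟩ ⟨a', e'⟩
  rw [zMeasure_eq_cqState, cqState_apply]
  simp only [reducedAE, pureState, Matrix.vecMulVec_apply, Pi.star_apply, Fintype.sum_prod_type,
    twirl_apply, diagBlock, Matrix.submatrix_apply, apply_ite star, star_zero, mul_ite, ite_mul,
    mul_zero, zero_mul, Finset.sum_ite_eq', Finset.mem_univ, if_true]
  rcases eq_or_ne a a' with rfl | h
  · simp only [if_true]
  · simp only [h, h.symm, if_false, Finset.sum_const_zero]

lemma trace_reducedAE [Fintype E] [Fintype C] (ψ : Bits n × E × C → ℂ) :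
    (reducedAE ψ).trace = (pureState ψ).trace := by
  simp only [Matrix.trace, Matrix.diag_apply, reducedAE, Fintype.sum_prod_type]

end Twirl

namespace Scheme

variable {n m l c : ℕ} {A' B' E T R I J 𝒰 𝒢 : Type*}
  [Fintype A'] [DecidableEq A'] [Fintype B'] [DecidableEq B'] [Fintype E] [DecidableEq E]
  [Fintype T] [DecidableEq T] [Fintype R] [Fintype I] [Fintype J]
  [Fintype 𝒰] [Fintype 𝒢]
  (S : Scheme n m l c A' B' E T R I J 𝒰 𝒢)
  {C : Type*} [Fintype C] {φ : Bits n × (E × T) × C → ℂ}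
  {h : 𝒢 → Matrix (Fin (n - m)) (Fin n) (ZMod 2)}
  {M : 𝒢 → Bits (n - m) → Bits n → Matrix (C × Bits n) (C × Bits n) ℂ}

lemma isPurification_twirl (hφ : IsSemiPurification φ S.siftedAE) :
    IsPurification (twirl φ) S.siftedAE :=
  (reducedAE_twirl φ).trans hφ

lemma isSubnormalized_pureState_twirl (hφ : IsSemiPurification φ S.siftedAE) :
    IsSubnormalized (pureState (twirl φ)) := by
  refine ⟨posSemidef_pureState _, ?_⟩
  rw [← trace_reducedAE, S.isPurification_twirl hφ]
  exact S.isSubnormalized_siftedAE.2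

variable [DecidableEq C]

lemma hashBlock_pec_twirl (hφ : IsSemiPurification φ S.siftedAE)
    (hh : ∀ i, h i * (LinearMap.toMatrix' (S.g i))ᵀ = 0)
    (hM : ∀ i s, ∑ e, (M i s e)ᴴ * M i s e = 1) (i : 𝒢) (k : Bits m) :
    hashBlock (S.g i) k (pec (h i) (M i) (pureState (twirl φ))) =
      ∑ a with S.g i a = k, S.siftedA a := by
  rw [hashBlock_pec (hh i) (hM i), hashBlock_pureState, S.isPurification_twirl hφ,
    siftedAE_eq_cqState, diagBlock_cqState]

variable [DecidableEq 𝒢]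

lemma virtualFinal_eq_keyState : S.virtualFinal h M φ = keyState S.pG fun i k =>
    hashBlock (S.g i) k (pec (h i) (M i) (pureState (twirl φ))) := by
  ext ⟨k, e, i⟩ ⟨k', e', i'⟩
  simp only [virtualFinal, bitMeasure, keyState, hashBlock, Matrix.submatrix_apply,
    Equiv.prodAssoc_symm_apply, Matrix.sum_apply, Matrix.smul_apply, Matrix.kroneckerMap_apply,
    Finset.sum_mul, Finset.smul_sum, mul_assoc]

lemma virtualFinal_eq_finalAlice [DecidableEq 𝒰] (hφ : IsSemiPurification φ S.siftedAE)
    (hh : ∀ i, h i * (LinearMap.toMatrix' (S.g i))ᵀ = 0)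
    (hM : ∀ i s, ∑ e, (M i s e)ᴴ * M i s e = 1) : S.virtualFinal h M φ = S.finalAlice := by
  simp only [virtualFinal_eq_keyState, finalAlice_eq_keyState, S.hashBlock_pec_twirl hφ hh hM]

lemma d₁_virtualFinal_le (hφ : IsSemiPurification φ S.siftedAE)
    (hh : ∀ i, h i * (LinearMap.toMatrix' (S.g i))ᵀ = 0)
    (hM : ∀ i s, ∑ e, (M i s e)ᴴ * M i s e = 1) :
    d₁ S.pG (S.virtualFinal h M φ) ≤ 2 * √2 * √(∑ i, S.pG i *
      phaseError (pec (h i) (M i) (pureState (twirl φ)))) := by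
  set ω := fun i => pec (h i) (M i) (pureState (twirl φ))
  have hω (i : 𝒢) : IsSubnormalized (ω i) :=
    isSubnormalized_pec (hh i) (hM i) (S.isSubnormalized_pureState_twirl hφ)
  have hEve (i : 𝒢) : trSnd (trFst (ω i)) = trSnd (trFst (pureState (twirl φ))) :=
    trSnd_trFst_pec (hh i) (hM i)
  have herror (i : 𝒢) : 0 ≤ phaseError (ω i) :=
    sub_nonneg.2 (re_star_phaseKet_dotProduct_le_one (hω i))
  rw [virtualFinal_eq_keyState]
  refine d₁_keyState_le S.pG_prob (fun i => sum_hashBlock.trans (hEve i)) fun V hV => ?_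
  calc ∑ i, S.pG i * ∑ k, (V i k * (hashBlock (S.g i) k (ω i) -
        (2 : ℝ) ^ (-(m : ℝ)) • trSnd (trFst (pureState (twirl φ))))).trace.re
      ≤ ∑ i, S.pG i * (2 * √2 * √(phaseError (ω i))) := by
        gcongr with i
        · exact S.pG_prob.1 i
        · rw [← hEve i]
          exact sum_re_trace_hashBlock_sub_le (S.g_surj i) (hV i) (hω i)
    _ = 2 * √2 * ∑ i, S.pG i * √(phaseError (ω i)) := by
        rw [Finset.mul_sum]
        exact Finset.sum_congr rfl fun i _ => by ring
    _ ≤ 2 * √2 * √(∑ i, S.pG i * phaseError (ω i)) := by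
        gcongr
        simpa [Real.sq_sqrt, herror] using
          sum_mul_sum_le_sqrt S.pG_prob fun i (_ : Unit) => √(phaseError (ω i))

end Scheme

section Purification

variable {α β γ : Type*}

lemma exists_purification [Fintype α] {ρ : Matrix α α ℂ} (hρ : ρ.PosSemidef) :
    ∃ ψ : α × α → ℂ, trSnd (pureState ψ) = ρ := by
  classical
  refine ⟨fun x => CFC.sqrt ρ x.1 x.2, ?_⟩
  calc trSnd (pureState fun x => CFC.sqrt ρ x.1 x.2) = CFC.sqrt ρ * (CFC.sqrt ρ)ᴴ := rfl
    _ = (CFC.sqrt ρ)ᴴ * CFC.sqrt ρ := by rw [(isHermitian_sqrt ρ).eq]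
    _ = ρ := conjTranspose_sqrt_mul_sqrt hρ

lemma trFst_kronecker_one_mul_mul_conjTranspose [Fintype α] [Fintype β] [DecidableEq β]
    [Fintype γ] (X : Matrix γ α ℂ) (ρ : Matrix (α × β) (α × β) ℂ) :
    trFst ((X ⊗ₖ (1 : Matrix β β ℂ)) * ρ * (X ⊗ₖ (1 : Matrix β β ℂ))ᴴ) =
      trFst (((Xᴴ * X) ⊗ₖ (1 : Matrix β β ℂ)) * ρ) := by
  ext e e'
  simp only [trFst, Matrix.mul_apply, Matrix.kroneckerMap_apply, Matrix.conjTranspose_apply,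
    Matrix.one_apply, Fintype.sum_prod_type, mul_ite, mul_one, mul_zero, ite_mul, zero_mul,
    Finset.sum_ite_eq, Finset.mem_univ, if_true, apply_ite star, star_zero, Finset.sum_mul]
  rw [Finset.sum_comm]
  refine Finset.sum_congr rfl fun z _ => Finset.sum_comm.trans <|
    Finset.sum_congr rfl fun w _ => Finset.sum_congr rfl fun x _ => by ring

end Purification

namespace Scheme

variable {n m l c : ℕ} {A' B' E T R I J 𝒰 𝒢 : Type*}
  [Fintype A'] [DecidableEq A'] [Fintype B'] [DecidableEq B'] [Fintype E] [DecidableEq E]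
  [Fintype R] [Fintype I] [Fintype J] [Fintype 𝒰] [Fintype 𝒢]
  (S : Scheme n m l c A' B' E T R I J 𝒰 𝒢)

lemma sum_conjTranspose_sifA_kronecker_sifB_mul_self (a : Bits n) (i : I) :
    ∑ b, ∑ j, (S.sifA a i ⊗ₖ S.sifB b j)ᴴ * (S.sifA a i ⊗ₖ S.sifB b j) =
      (S.sifA a i ⊗ₖ (1 : Matrix B' B' ℂ))ᴴ * (S.sifA a i ⊗ₖ (1 : Matrix B' B' ℂ)) := by
  simp only [Matrix.conjTranspose_kronecker, ← Matrix.mul_kronecker_mul, ← kronecker_sum,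
    S.sifB_sum, Matrix.conjTranspose_one, Matrix.one_mul]

/-- The operator of the sample measurement with outcome `r`, its announcement, and Alice's sifted
key measurement with outcomes `a`, `i`. -/
def aliceOperator [DecidableEq T] (a : Bits n) (i : I) (r : R) :
    Matrix ((A' × B') × (E × T)) ((A' × B') × E) ℂ :=
  ((S.sifA a i ⊗ₖ (1 : Matrix B' B' ℂ)) * S.smp r) ⊗ₖ announce E (S.ann r)

/-- Bob's measurement does not disturb the joint state of Alice and Eve. -/
lemma siftedA_eq_sum_trFst [Fintype T] [DecidableEq T] (a : Bits n) :
    S.siftedA a =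
      ∑ i, ∑ r ∈ S.accept, trFst (S.aliceOperator a i r * S.ini * (S.aliceOperator a i r)ᴴ) := by
  have hoperator (i : I) (r : R) : S.aliceOperator a i r =
      ((S.sifA a i ⊗ₖ (1 : Matrix B' B' ℂ)) ⊗ₖ (1 : Matrix (E × T) (E × T) ℂ)) *
        (S.smp r ⊗ₖ announce E (S.ann r)) := by
    rw [aliceOperator, ← Matrix.mul_kronecker_mul, Matrix.one_mul]
  calc S.siftedA a
      = ∑ i, ∑ b, ∑ j, trFst (((S.sifA a i ⊗ₖ S.sifB b j) ⊗ₖ (1 : Matrix (E × T) (E × T) ℂ)) *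
          S.sampled * ((S.sifA a i ⊗ₖ S.sifB b j) ⊗ₖ (1 : Matrix (E × T) (E × T) ℂ))ᴴ) := by
        simp only [siftedA, siftedBlock, trFst_sum]
        exact Finset.sum_comm
    _ = ∑ i, trFst (((S.sifA a i ⊗ₖ (1 : Matrix B' B' ℂ)) ⊗ₖ (1 : Matrix (E × T) (E × T) ℂ)) *
          S.sampled *
          ((S.sifA a i ⊗ₖ (1 : Matrix B' B' ℂ)) ⊗ₖ (1 : Matrix (E × T) (E × T) ℂ))ᴴ) := by
        simp only [trFst_kronecker_one_mul_mul_conjTranspose, ← trFst_sum, ← Finset.sum_mul,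
          ← sum_kronecker, sum_conjTranspose_sifA_kronecker_sifB_mul_self]
    _ = ∑ i, ∑ r ∈ S.accept, trFst (S.aliceOperator a i r * S.ini *
          (S.aliceOperator a i r)ᴴ) := by
        simp only [sampled, Finset.mul_sum, Finset.sum_mul, trFst_sum, hoperator,
          Matrix.conjTranspose_mul, Matrix.mul_assoc]

variable [DecidableEq T] [DecidableEq R] {P : Type*} (ψ : ((A' × B') × E) × P → ℂ)

lemma prepared_apply (a : Bits n) (e : E × T) (z : A' × B') (p : P) (r : R) (i : I) :
    S.prepared ψ (a, e, (z, p, r, i)) =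
      if r ∈ S.accept then (S.aliceOperator a i r * Matrix.of fun x p => ψ (x, p)) (z, e) p
      else 0 := by
  obtain ⟨e, t⟩ := e
  simp [prepared, aliceOperator, Matrix.mul_apply (N := Matrix.of _), Fintype.sum_prod_type,
    announce, ite_and]

lemma diagBlock_reducedAE_prepared [Fintype P] (a : Bits n) :
    diagBlock (reducedAE (S.prepared ψ)) a = ∑ i, ∑ r ∈ S.accept,
      trFst (S.aliceOperator a i r * trSnd (pureState ψ) * (S.aliceOperator a i r)ᴴ) := by
  set Ψ : Matrix ((A' × B') × E) P ℂ := Matrix.of fun x p => ψ (x, p)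
  have hψ : trSnd (pureState ψ) = Ψ * Ψᴴ := rfl
  ext e e'
  calc diagBlock (reducedAE (S.prepared ψ)) a e e'
      = ∑ z, ∑ p, ∑ r, ∑ i, S.prepared ψ (a, e, (z, p, r, i)) *
          star (S.prepared ψ (a, e', (z, p, r, i))) := by
        simp only [diagBlock, Matrix.submatrix_apply, reducedAE, pureState, Matrix.vecMulVec_apply,
          Pi.star_apply, Fintype.sum_prod_type (α₁ := A' × B'), Fintype.sum_prod_type (α₁ := P),
          Fintype.sum_prod_type (α₁ := R)]
    _ = ∑ i, ∑ r, ∑ z, ∑ p, S.prepared ψ (a, e, (z, p, r, i)) *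
          star (S.prepared ψ (a, e', (z, p, r, i))) := by
        rw [Finset.sum_comm_cycle, Finset.sum_congr rfl fun r _ => Finset.sum_comm_cycle,
          Finset.sum_comm]
    _ = ∑ i, ∑ r ∈ S.accept, ∑ z, ∑ p, (S.aliceOperator a i r * Ψ) (z, e) p *
          star ((S.aliceOperator a i r * Ψ) (z, e') p) := by
        simp only [prepared_apply, apply_ite star, star_zero, mul_ite, ite_mul, mul_zero,
          zero_mul, Finset.sum_ite_irrel, Finset.sum_const_zero, Finset.sum_ite_mem,
          Finset.univ_inter, Finset.inter_self]
        rfl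
    _ = (∑ i, ∑ r ∈ S.accept, trFst ((S.aliceOperator a i r * Ψ) *
          (S.aliceOperator a i r * Ψ)ᴴ)) e e' := by
        simp only [Matrix.sum_apply]
        rfl
    _ = _ := by simp only [hψ, Matrix.conjTranspose_mul, Matrix.mul_assoc]

lemma isSemiPurification_prepared [Fintype T] [Fintype P] {ψ : ((A' × B') × E) × P → ℂ}
    (hψ : trSnd (pureState ψ) = S.ini) : IsSemiPurification (S.prepared ψ) S.siftedAE := by
  rw [IsSemiPurification, zMeasure_eq_cqState, siftedAE_eq_cqState]
  congr 1
  ext1 a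
  rw [diagBlock_reducedAE_prepared, hψ, siftedA_eq_sum_trFst]

end Scheme

end QKD

end

theorem mainTheorem4 {n m l c : ℕ} {A' B' E T R I J 𝒰 𝒢 : Type*}
    [Fintype A'] [DecidableEq A'] [Fintype B'] [DecidableEq B'] [Fintype E] [DecidableEq E]
    [Fintype T] [DecidableEq T] [Fintype R] [DecidableEq R] [Fintype I] [Fintype J]
    [Fintype 𝒰] [DecidableEq 𝒰] [Fintype 𝒢] [DecidableEq 𝒢]
    (S : QKD.Scheme n m l c A' B' E T R I J 𝒰 𝒢) (ε Hth : ℝ)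
    (hSM : (Hth : EReal) ≤ QKD.smoothMinEntropy ε S.siftedAE) :
    -- security of the actual scheme
    QKD.D₁ S.pG S.final ≤
      (2 : ℝ) ^ (-(l : ℝ) + 1) + 2 * ε + (2 : ℝ) ^ (((m : ℝ) - Hth + 3) / 2) ∧
    -- purification of the initial state and preparation of a semi-purification of the sifted key
    (∃ ψ : ((A' × B') × E) × ((A' × B') × E) → ℂ, QKD.trSnd (QKD.pureState ψ) = S.ini) ∧
    (∀ (P : Type*) [Fintype P] (ψ : ((A' × B') × E) × P → ℂ),
      QKD.trSnd (QKD.pureState ψ) = S.ini →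
        QKD.IsSemiPurification (S.prepared ψ) S.siftedAE) ∧
    -- the virtual scheme with twirling and embedded phase error correction
    (∀ (C : Type*) [Fintype C] [DecidableEq C] (φ : QKD.Bits n × (E × T) × C → ℂ)
      (h : 𝒢 → Matrix (Fin (n - m)) (Fin n) (ZMod 2))
      (M : 𝒢 → QKD.Bits (n - m) → QKD.Bits n → Matrix (C × QKD.Bits n) (C × QKD.Bits n) ℂ),
      QKD.IsSemiPurification φ S.siftedAE →
      (∀ g, QKD.IsCheckMatrix (S.g g) (h g)) →
      (∀ g s, ∑ e, (M g s e)ᴴ * M g s e = 1) →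
        QKD.IsPurification (QKD.twirl φ) S.siftedAE ∧
        S.virtualFinal h M φ = S.finalAlice ∧
        QKD.d₁ S.pG (S.virtualFinal h M φ) ≤
          2 * √2 * √(∑ g, S.pG g *
            QKD.phaseError (QKD.pec (h g) (M g) (QKD.pureState (QKD.twirl φ)))) ∧
        QKD.d₁ S.pG (S.virtualFinal h M φ) ≤
          2 * ε + (2 : ℝ) ^ (((m : ℝ) - Hth + 3) / 2)) := by
  refine ⟨S.D₁_final_le hSM, QKD.exists_purification S.ini_sub.1,
    fun P _ ψ hψ => S.isSemiPurification_prepared hψ, fun C _ _ φ h M hφ hh hM => ?_⟩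
  have hcheck (g : 𝒢) : h g * (LinearMap.toMatrix' (S.g g))ᵀ = 0 := (hh g).2
  have heq : S.virtualFinal h M φ = S.finalAlice := S.virtualFinal_eq_finalAlice hφ hcheck hM
  exact ⟨S.isPurification_twirl hφ, heq, S.d₁_virtualFinal_le hφ hcheck hM,
    heq ▸ S.d₁_finalAlice_le hSM⟩
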